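/- Let $n_T,n_R\ge 1$, $n_E\ge 0$ be integers, $N_m,N_e>0$, and let $\mathbf H_m\in\mathbb C^{n_R\times n_T}$, $\mathbf H_e\in\mathbb C^{n_E\times n_T}$ be fixed channel matrices. For a positive semidefinite $\mathbf K\in\mathbb C^{n_T\times n_T}$ put $$R(\mathbf K)=\frac1{n_R}\Big(\log\det\big(\mathbf I+\tfrac1{N_m}\mathbf H_m\mathbf K\mathbf H_m^\dagger\big)-\log\det\big(\mathbf I+\tfrac1{N_e}\mathbf H_e\mathbf K\mathbf H_e^\dagger\big)\Big),$$ and for $\mathrm{SNR}\ge 0$ let the secrecy capacity be $$C_s(\mathrm{SNR})=\max\{R(\mathbf K_x):\ \mathbf K_x\succeq 0,\ \operatorname{tr}\mathbf K_x\le P\},\qquad P=n_RN_m\,\mathrm{SNR}.$$ Let $\boldsymbol\Phi=\mathbf H_m^\dagger\mathbf H_m-\frac{N_m}{N_e}\mathbf H_e^\dagger\mathbf H_e$, let $\lambda_{\max}(\boldsymbol\Phi)$ be its largest eigenvalue, $E$ the eigenspace of that eigenvalue, and $l=\dim E$. Then the maximum is attained for every $\mathrm{SNR}\ge0$, $C_s$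 is differentiable on $[0,\varepsilon)$ for some $\varepsilon>0$, and the following holds (derivatives at $0$ are from the right). 1. $\dot C_s(0)=[\lambda_{\max}(\boldsymbol\Phi)]^+$. 2. The second derivative $\ddot C_s(0)$ (the derivative of $\dot C_s$ at $0$) exists. If $\lambda_{\max}(\boldsymbol\Phi)\le 0$, then $\ddot C_s(0)=0$. If $\lambda_{\max}(\boldsymbol\Phi)>0$, then $$\ddot C_s(0)=-n_R\min_{\{\mathbf u_i\},\{\alpha_i\}}\ \sum_{i,j=1}^{l}\alpha_i\alpha_j\Big(|\mathbf u_j^\dagger\mathbf H_m^\dagger\mathbf H_m\mathbf u_i|^2-\tfrac{N_m^2}{N_e^2}|\mathbf u_j^\dagger\mathbf H_e^\dagger\mathbf H_e\mathbf u_i|^2\Big),$$ where the minimum, which is attained, is over all orthonormal bases $\{\mathbf u_i\}_{i=1}^l$ of $E$ and all weights $\alpha_i\in[0,1]$ with $\sum_{i=1}^l\alpha_i=1$. Moreover, $E$ has an orthonormal basis with $\mathbf u_j^\dagger\mathbf H_m^\dagger\mathbf H_m\mathbf u_i=0$ for all $i\ne j$, and for each such fixed basis the minimum over $\{\alpha_i\}$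 alone has the same value. 3. For every orthonormal basis $\{\mathbf u_i\}$ of $E$ and all weights $\alpha_i\in[0,1]$ with $\sum_i\alpha_i=1$, the covariance $\mathbf K_x=P\sum_{i=1}^l\alpha_i\mathbf u_i\mathbf u_i^\dagger$ satisfies the power constraint, and if $\lambda_{\max}(\boldsymbol\Phi)\ge 0$, then the rate $\mathrm{SNR}\mapsto R(\mathbf K_x)$ has derivative $\dot C_s(0)$ at $\mathrm{SNR}=0$: the first derivative is attained by transmission in $E$. -/

import Mathlib

open scoped ComplexOrder Matrix

noncomputable section

namespace Wiretap

variable {nT nR nE : ℕ}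

/-- Secrecy rate, in nats per dimension, of the Gaussian input with covariance matrix `K`:
`(1 / n_R) (log det (I + H_m K H_m† / N_m) - log det (I + H_e K H_e† / N_e))`.
For `K` positive semidefinite both determinants are real and at least `1`. -/
def secrecyRate (Hm : Matrix (Fin nR) (Fin nT) ℂ) (He : Matrix (Fin nE) (Fin nT) ℂ)
    (Nm Ne : ℝ) (K : Matrix (Fin nT) (Fin nT) ℂ) : ℝ :=
  (1 / (nR : ℝ)) *
    (Real.log (1 + (1 / Nm) • (Hm * K * Hmᴴ)).det.re
      - Real.log (1 + (1 / Ne) • (He * K * Heᴴ)).det.re)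

/-- Covariance matrices allowed by the power constraint `tr K ≤ P`. -/
def admissible (nT : ℕ) (P : ℝ) : Set (Matrix (Fin nT) (Fin nT) ℂ) :=
  {K | K.PosSemidef ∧ K.trace.re ≤ P}

/-- The input power `P = n_R N_m SNR` that corresponds to the signal-to-noise ratio
`SNR = P / (n_R N_m)`. -/
def power (nR : ℕ) (Nm snr : ℝ) : ℝ := nR * Nm * snr

/-- The secrecy capacity as a function of the signal-to-noise ratio, which is meaningful
for `0 ≤ snr`. -/
def secrecyCapacity (Hm : Matrix (Fin nR) (Fin nT) ℂ) (He : Matrix (Fin nE) (Fin nT) ℂ)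
    (Nm Ne : ℝ) (snr : ℝ) : ℝ :=
  sSup (secrecyRate Hm He Nm Ne '' admissible nT (power nR Nm snr))

/-- `Φ = H_m† H_m - (N_m / N_e) H_e† H_e`. -/
def Phi (Hm : Matrix (Fin nR) (Fin nT) ℂ) (He : Matrix (Fin nE) (Fin nT) ℂ)
    (Nm Ne : ℝ) : Matrix (Fin nT) (Fin nT) ℂ :=
  Hmᴴ * Hm - (Nm / Ne) • (Heᴴ * He)

theorem isHermitian_Phi (Hm : Matrix (Fin nR) (Fin nT) ℂ) (He : Matrix (Fin nE) (Fin nT) ℂ)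
    (Nm Ne : ℝ) : (Phi Hm He Nm Ne).IsHermitian := by
  simp [Phi, Matrix.IsHermitian, Matrix.conjTranspose_sub, Matrix.conjTranspose_smul,
    Matrix.conjTranspose_mul]

/-- The largest eigenvalue of `Φ` (a maximum of finitely many real numbers if `0 < nT`). -/
def lambdaMax (Hm : Matrix (Fin nR) (Fin nT) ℂ) (He : Matrix (Fin nE) (Fin nT) ℂ)
    (Nm Ne : ℝ) : ℝ :=
  ⨆ i, (isHermitian_Phi Hm He Nm Ne).eigenvalues i

/-- The eigenspace of `Φ` for its largest eigenvalue. -/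
abbrev topEigenspace (Hm : Matrix (Fin nR) (Fin nT) ℂ) (He : Matrix (Fin nE) (Fin nT) ℂ)
    (Nm Ne : ℝ) : Submodule ℂ (EuclideanSpace ℂ (Fin nT)) :=
  Module.End.eigenspace (Matrix.toEuclideanLin (Phi Hm He Nm Ne)) (lambdaMax Hm He Nm Ne : ℂ)

/-- The multiplicity `l` of the largest eigenvalue of `Φ`. -/
abbrev multiplicity (Hm : Matrix (Fin nR) (Fin nT) ℂ) (He : Matrix (Fin nE) (Fin nT) ℂ)
    (Nm Ne : ℝ) : ℕ :=
  Module.finrank ℂ (topEigenspace Hm He Nm Ne)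

/-- Orthonormal bases `u_1, …, u_l` of the eigenspace of `Φ` for its largest eigenvalue. -/
abbrev TopBasis (Hm : Matrix (Fin nR) (Fin nT) ℂ) (He : Matrix (Fin nE) (Fin nT) ℂ)
    (Nm Ne : ℝ) : Type :=
  OrthonormalBasis (Fin (multiplicity Hm He Nm Ne)) ℂ (topEigenspace Hm He Nm Ne)

/-- The coordinate vector of `u_i` in `ℂ^(n_T)`. -/
def TopBasis.vec {Hm : Matrix (Fin nR) (Fin nT) ℂ} {He : Matrix (Fin nE) (Fin nT) ℂ}
    {Nm Ne : ℝ} (u : TopBasis Hm He Nm Ne) (i : Fin (multiplicity Hm He Nm Ne)) : Fin nT → ℂ :=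
  WithLp.ofLp (u i : EuclideanSpace ℂ (Fin nT))

/-- `∑_{i,j} α_i α_j (|u_j† H_m† H_m u_i|² - (N_m² / N_e²) |u_j† H_e† H_e u_i|²)`. -/
def quadForm {Hm : Matrix (Fin nR) (Fin nT) ℂ} {He : Matrix (Fin nE) (Fin nT) ℂ}
    {Nm Ne : ℝ} (u : TopBasis Hm He Nm Ne) (α : Fin (multiplicity Hm He Nm Ne) → ℝ) : ℝ :=
  ∑ i, ∑ j, α i * α j *
    (‖star (u.vec j) ⬝ᵥ (Hmᴴ * Hm) *ᵥ u.vec i‖ ^ 2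
      - Nm ^ 2 / Ne ^ 2 * ‖star (u.vec j) ⬝ᵥ (Heᴴ * He) *ᵥ u.vec i‖ ^ 2)

/-- The covariance matrix `∑_i α_i u_i u_i†`. -/
def eigenCov {Hm : Matrix (Fin nR) (Fin nT) ℂ} {He : Matrix (Fin nE) (Fin nT) ℂ}
    {Nm Ne : ℝ} (u : TopBasis Hm He Nm Ne) (α : Fin (multiplicity Hm He Nm Ne) → ℝ) :
    Matrix (Fin nT) (Fin nT) ℂ :=
  ∑ i, α i • Matrix.vecMulVec (u.vec i) (star (u.vec i))

end Wiretap

end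

/-! Absorb √(Nm/Ne) into `He` and write K = P Q with tr Q ≤ 1. The problem becomes the value
function `gapSup` t = max_Q `gap` (t Q), where `gap` is a difference of two log-determinants with
Gram matrices A = H₁†H₁, B = H₂†H₂ and A − B = Φ; the capacity is `gapSup` (nR · SNR) / nR. If the
top eigenvalue r of Φ is ≤ 0, then A ≤ B and the capacity vanishes (`gapSup_eq_zero`).

Let r > 0. The gap need not be concave, so the regularity of its maximum requires an argument. Minus
its second derivative at 0 is `curv`. If D is Hermitian and ΦD = rD, that is AD = BD + rD, then
squaring gives tr (AD)² − tr (BD)² = 2r tr(BD²) + r²‖D‖² ≥ r²‖D‖²: the gap is strongly concave at 0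
in such directions, and `le_curv_self` allows a defect. A maximizer Q_t also maximizes X ↦ tr(g_t
X), with g_t the gradient at t Q_t, so g_t Q_t = μ Q_t and D = Q_s − Q_t is an eigenmatrix of Φ up
to a small error. Adding the optimality inequalities for s and t gives tr((g_s − g_t) D) ≥ 0, while
the left side is about −t curv(D, D). Hence t‖Q_s − Q_t‖ ≤ C|s − t| for small s, t
(`mul_norm_sub_le_of_isTraceMax`), and an envelope argument shows that the value has derivative ψ(t)
= tr(g_t Q_t).

For the slope of ψ at 0: ψ(t) ≤ r − t curv(Q_t, Q_t) + O(t²), and ψ(t) ≥ tr(g_t P) = r − t curv(Q_t,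
P) + O(t²) for each maximizer P of tr(Φ ·). A limit point Q of Q_t therefore maximizes tr(Φ ·) and
satisfies curv(Q, Q) ≤ curv(Q, P). Convexity of `curv` on the maximizing face makes Q a minimizer of
it (`curv_self_le_of_forall`), and P = Q squeezes the slope to minus the minimum.

That face consists of the trace-one covariances supported in E. The spectral theorem writes each as
∑ α_i u_i u_i†, and `curv` becomes `quadForm`. In a basis that diagonalizes the compression of A,
that of B = A − Φ is diagonal too, and `curv` is a nonnegative combination of squared moduli of
entries, so dropping the off-diagonal ones only lowers it. -/

noncomputable section

namespace Wiretap

/-! ### Frobenius norm and traces of products -/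

section Trace

open scoped Matrix.Norms.Frobenius

variable {m n : Type*} [Fintype m] [Fintype n]

theorem exists_eq_conjTranspose_mul_self {Q : Matrix n n ℂ} (hQ : Q.PosSemidef) :
    ∃ C : Matrix n n ℂ, Q = Cᴴ * C := by
  classical
  open scoped MatrixOrder in
  exact (CStarAlgebra.nonneg_iff_eq_star_mul_self).1 (Matrix.nonneg_iff_posSemidef.2 hQ)

theorem frobenius_norm_sq (X : Matrix m n ℂ) : ‖X‖ ^ 2 = ∑ i, ∑ j, ‖X i j‖ ^ 2 := by
  rw [Matrix.frobenius_norm_def, ← Real.sqrt_eq_rpow, Real.sq_sqrt (by positivity)]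
  simp

theorem trace_conjTranspose_mul_self_re (X : Matrix m n ℂ) :
    (Xᴴ * X).trace.re = ‖X‖ ^ 2 := by
  rw [frobenius_norm_sq, Finset.sum_comm, Matrix.trace, Complex.re_sum]
  refine Finset.sum_congr rfl fun i _ => ?_
  rw [Matrix.diag_apply, Matrix.mul_apply, Complex.re_sum]
  refine Finset.sum_congr rfl fun j _ => ?_
  rw [Matrix.conjTranspose_apply, ← Complex.normSq_eq_norm_sq, Complex.normSq_apply]
  simp

theorem norm_trace_mul_le (X : Matrix m n ℂ) (Y : Matrix n m ℂ) :
    ‖(X * Y).trace‖ ≤ ‖X‖ * ‖Y‖ := by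
  have h1 : ‖(X * Y).trace‖ ≤ ∑ p : m × n, ‖X p.1 p.2‖ * ‖Y p.2 p.1‖ := by
    rw [Matrix.trace, Fintype.sum_prod_type]
    refine (norm_sum_le _ _).trans (Finset.sum_le_sum fun i _ => ?_)
    rw [Matrix.diag_apply, Matrix.mul_apply]
    exact (norm_sum_le _ _).trans (Finset.sum_le_sum fun j _ => (norm_mul _ _).le)
  refine h1.trans (le_of_sq_le_sq ?_ (by positivity))
  refine (Finset.sum_mul_sq_le_sq_mul_sq _ _ _).trans (le_of_eq ?_)
  rw [mul_pow, frobenius_norm_sq, frobenius_norm_sq, Fintype.sum_prod_type,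
    Fintype.sum_prod_type, Finset.sum_comm (γ := n) (α := m)]

theorem abs_trace_re_mul_le (X : Matrix m n ℂ) (Y : Matrix n m ℂ) :
    |(X * Y).trace.re| ≤ ‖X‖ * ‖Y‖ :=
  (Complex.abs_re_le_norm _).trans (norm_trace_mul_le X Y)

theorem trace_mul_nonneg {X Y : Matrix n n ℂ} (hX : X.PosSemidef) (hY : Y.PosSemidef) :
    0 ≤ (X * Y).trace.re := by
  obtain ⟨C, rfl⟩ := exists_eq_conjTranspose_mul_self hY
  rw [← Matrix.mul_assoc, Matrix.trace_mul_comm, ← Matrix.mul_assoc]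
  exact (Complex.nonneg_iff.1 (hX.mul_mul_conjTranspose_same C).trace_nonneg).1

/-- With X = E†E and Y = C†C the trace is ‖E C†‖². This is what turns an inequality of traces into
complementary slackness. -/
theorem mul_eq_zero_of_trace_nonpos {X Y : Matrix n n ℂ} (hX : X.PosSemidef)
    (hY : Y.PosSemidef) (h : (X * Y).trace.re ≤ 0) : X * Y = 0 := by
  obtain ⟨C, rfl⟩ := exists_eq_conjTranspose_mul_self hY
  obtain ⟨E, rfl⟩ := exists_eq_conjTranspose_mul_self hX
  have h1 : (Eᴴ * E * (Cᴴ * C)).trace.re = ‖E * Cᴴ‖ ^ 2 := by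
    rw [← trace_conjTranspose_mul_self_re, Matrix.conjTranspose_mul,
      Matrix.conjTranspose_conjTranspose, ← Matrix.mul_assoc, Matrix.trace_mul_comm]
    simp only [Matrix.mul_assoc]
  have h2 : E * Cᴴ = 0 := by
    rw [← norm_eq_zero]
    exact pow_eq_zero_iff (two_ne_zero) |>.1 (le_antisymm (h1 ▸ h) (sq_nonneg _))
  rw [Matrix.mul_assoc, ← Matrix.mul_assoc E, h2]
  simp

theorem trace_mul_self_re {X : Matrix n n ℂ} (hX : X.IsHermitian) :
    (X * X).trace.re = ‖X‖ ^ 2 := by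
  rw [← trace_conjTranspose_mul_self_re, hX.eq]

theorem norm_le_trace {Q : Matrix n n ℂ} (hQ : Q.PosSemidef) : ‖Q‖ ≤ Q.trace.re := by
  obtain ⟨C, rfl⟩ := exists_eq_conjTranspose_mul_self hQ
  rw [trace_conjTranspose_mul_self_re, sq]
  exact (Matrix.frobenius_norm_mul _ _).trans_eq (by rw [Matrix.frobenius_norm_conjTranspose])

end Trace

/-! ### Derivative of log det along a line -/

section Det

variable {m : Type*} [Fintype m] [DecidableEq m]

theorem hasDerivAt_det_one_add (M : Matrix m m ℂ) :
    HasDerivAt (fun r : ℂ => (1 + r • M).det) M.trace 0 := by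
  have h := (1 + (Polynomial.X : Polynomial ℂ) • M.map Polynomial.C).det.hasDerivAt 0
  rw [Matrix.derivative_det_one_add_X_smul] at h
  refine h.congr_of_eventuallyEq (Filter.Eventually.of_forall fun r => ?_)
  simp [_root_.eval_det, ← Matrix.smul_eq_mul_diagonal]

theorem hasDerivAt_log_det {M N : Matrix m m ℂ} {x : ℝ} (hM : (M + x • N).PosDef) :
    HasDerivAt (fun y : ℝ => Real.log (M + y • N).det.re) ((M + x • N)⁻¹ * N).trace.re x := by
  set P := M + x • N with hP
  have hu : IsUnit P.det := (Matrix.isUnit_iff_isUnit_det _).1 hM.isUnit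
  have hpos : 0 < P.det := hM.det_pos
  -- Factoring out the determinant at the base point reduces the derivative to that of det(1 + r M)
  -- at r = 0.
  have hfac : ∀ y : ℝ, (M + y • N).det = P.det * (1 + ((y - x : ℝ) : ℂ) • (P⁻¹ * N)).det := by
    intro y
    rw [← Matrix.det_mul, Matrix.mul_add, Matrix.mul_smul, ← Matrix.mul_assoc,
      Matrix.mul_nonsing_inv _ hu, Matrix.mul_one, Matrix.one_mul, hP]
    congr 1
    ext i j
    simp
    ring
  have h1 : HasDerivAt (fun y : ℝ => (M + y • N).det) (P.det * (P⁻¹ * N).trace) x := by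
    simp_rw [hfac]
    have h2 : HasDerivAt (fun y : ℝ => ((y - x : ℝ) : ℂ)) 1 x := by
      simpa using ((hasDerivAt_id x).sub_const x).ofReal_comp
    have h3 := hasDerivAt_det_one_add (P⁻¹ * N)
    have h4 : HasDerivAt (fun r : ℂ => (1 + r • (P⁻¹ * N)).det) (P⁻¹ * N).trace
      (((x - x : ℝ) : ℂ)) := by simpa using h3
    simpa using (h4.comp x h2).const_mul P.det
  have h5 : HasDerivAt (fun y : ℝ => (M + y • N).det.re) (P.det * (P⁻¹ * N).trace).re x :=
    (Complex.reCLM.hasFDerivAt.comp_hasDerivAt x h1 :)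
  have h6 := h5.log (ne_of_gt (Complex.pos_iff.1 hpos).1)
  convert h6 using 1
  rw [Complex.mul_re, ← (Complex.pos_iff.1 hpos).2, zero_mul, sub_zero, ← hP]
  rw [mul_div_cancel_left₀ _ (ne_of_gt (Complex.pos_iff.1 hpos).1)]

end Det

/-! ### The function log det(I + H K H†) and its gradient -/

section LogDet

open scoped Matrix.Norms.Frobenius

variable {m n : Type*} [Fintype m] [DecidableEq m] [Fintype n]

/-- `log det (I + H K H†)`. -/
def logDet (H : Matrix m n ℂ) (K : Matrix n n ℂ) : ℝ :=
  Real.log (1 + H * K * Hᴴ).det.re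

/-- The gradient `H† (I + H K H†)⁻¹ H` of `logDet H` at `K`. -/
def logDetGrad (H : Matrix m n ℂ) (K : Matrix n n ℂ) : Matrix n n ℂ :=
  Hᴴ * (1 + H * K * Hᴴ)⁻¹ * H

variable (H : Matrix m n ℂ) {K K' : Matrix n n ℂ}

theorem posDef_one_add_mul_mul (hK : K.PosSemidef) : (1 + H * K * Hᴴ).PosDef :=
  Matrix.PosDef.one.add_posSemidef (hK.mul_mul_conjTranspose_same H)

theorem isHermitian_logDetGrad (hK : K.PosSemidef) : (logDetGrad H K).IsHermitian :=
  Matrix.isHermitian_conjTranspose_mul_mul H (posDef_one_add_mul_mul H hK).isHermitian.inv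

theorem logDetGrad_zero : logDetGrad H 0 = Hᴴ * H := by
  simp [logDetGrad]

/-- The resolvent identity, sandwiched between H† and H. All later estimates of the gradient come
from it. -/
theorem logDetGrad_sub (hK : K.PosSemidef) (hK' : K'.PosSemidef) :
    logDetGrad H K - logDetGrad H K' = logDetGrad H K * (K' - K) * logDetGrad H K' := by
  have h1 := (Matrix.isUnit_iff_isUnit_det _).1 (posDef_one_add_mul_mul H hK).isUnit
  have h2 := (Matrix.isUnit_iff_isUnit_det _).1 (posDef_one_add_mul_mul H hK').isUnit
  have h3 : (1 + H * K * Hᴴ)⁻¹ - (1 + H * K' * Hᴴ)⁻¹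
      = (1 + H * K * Hᴴ)⁻¹ * (H * (K' - K) * Hᴴ) * (1 + H * K' * Hᴴ)⁻¹ := by
    have h4 : H * (K' - K) * Hᴴ = (1 + H * K' * Hᴴ) - (1 + H * K * Hᴴ) := by
      rw [Matrix.mul_sub, Matrix.sub_mul]; abel
    rw [h4, Matrix.mul_sub, Matrix.nonsing_inv_mul _ h1, Matrix.sub_mul,
      Matrix.mul_nonsing_inv_cancel_right _ _ h2, Matrix.one_mul]
  rw [logDetGrad, logDetGrad, ← Matrix.sub_mul, ← Matrix.mul_sub, h3]
  simp only [Matrix.mul_assoc]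

theorem hasDerivAt_logDet {D : Matrix n n ℂ} {x : ℝ} (h : (K + x • D).PosSemidef) :
    HasDerivAt (fun y : ℝ => logDet H (K + y • D)) (logDetGrad H (K + x • D) * D).trace.re x := by
  have h0 : ∀ y : ℝ, 1 + H * (K + y • D) * Hᴴ = (1 + H * K * Hᴴ) + y • (H * D * Hᴴ) := by
    intro y
    rw [Matrix.mul_add, Matrix.add_mul, Matrix.mul_smul, Matrix.smul_mul, add_assoc]
  have h1 := posDef_one_add_mul_mul H h
  rw [h0] at h1
  have h2 := hasDerivAt_log_det h1
  simp only [logDet, logDetGrad, h0]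
  convert h2 using 2
  rw [Matrix.mul_assoc, Matrix.mul_assoc, Matrix.trace_mul_comm]
  simp only [Matrix.mul_assoc]

theorem logDet_zero : logDet H 0 = 0 := by
  simp [logDet]

theorem norm_logDetGrad_sub_le (hK : K.PosSemidef) (hK' : K'.PosSemidef) :
    ‖logDetGrad H K - logDetGrad H K'‖ ≤ ‖logDetGrad H K‖ * ‖K - K'‖ * ‖logDetGrad H K'‖ := by
  rw [logDetGrad_sub H hK hK', norm_sub_rev K]
  exact (Matrix.frobenius_norm_mul _ _).trans
    (mul_le_mul_of_nonneg_right (Matrix.frobenius_norm_mul _ _) (norm_nonneg _))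

/-- The resolvent identity against 0 gives ‖G‖ ≤ ‖A‖ + ‖G‖‖K‖‖A‖ with A = H†H; the smallness of K
bounds the last term by ‖G‖/2, which is absorbed on the left. -/
theorem norm_logDetGrad_le {a : ℝ} (hK : K.PosSemidef) (ha : ‖Hᴴ * H‖ ≤ a) (hKa : ‖K‖ * a ≤ 1 / 2) :
    ‖logDetGrad H K‖ ≤ 2 * a := by
  have h := norm_logDetGrad_sub_le H hK Matrix.PosSemidef.zero
  rw [logDetGrad_zero, sub_zero] at h
  have h1 := norm_le_norm_add_norm_sub' (logDetGrad H K) (Hᴴ * H)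
  have h2 : ‖logDetGrad H K‖ * ‖K‖ * ‖Hᴴ * H‖ ≤ ‖logDetGrad H K‖ * (1 / 2) := by
    rw [mul_assoc]
    exact mul_le_mul_of_nonneg_left
      ((mul_le_mul_of_nonneg_left ha (norm_nonneg _)).trans hKa) (norm_nonneg _)
  linarith

theorem continuousOn_logDet : ContinuousOn (logDet H) {K | K.PosSemidef} := by
  classical
  refine ContinuousOn.log (Continuous.continuousOn ?_) fun K hK =>
    ne_of_gt (Complex.pos_iff.1 (posDef_one_add_mul_mul H hK).det_pos).1
  fun_prop

end LogDet

/-! ### Difference of two log-determinants -/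

section Gap

open scoped Matrix.Norms.Frobenius

variable {m₁ m₂ n : Type*} [Fintype m₁] [DecidableEq m₁] [Fintype m₂] [DecidableEq m₂] [Fintype n]

/-- The difference of the two log-determinants. -/
def gap (H₁ : Matrix m₁ n ℂ) (H₂ : Matrix m₂ n ℂ) (K : Matrix n n ℂ) : ℝ :=
  logDet H₁ K - logDet H₂ K

/-- The gradient of `gap`. -/
def gapGrad (H₁ : Matrix m₁ n ℂ) (H₂ : Matrix m₂ n ℂ) (K : Matrix n n ℂ) : Matrix n n ℂ :=
  logDetGrad H₁ K - logDetGrad H₂ K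

variable (H₁ : Matrix m₁ n ℂ) (H₂ : Matrix m₂ n ℂ) {K K' : Matrix n n ℂ}

theorem gap_zero : gap H₁ H₂ 0 = 0 := by simp [gap, logDet_zero]

theorem gapGrad_zero : gapGrad H₁ H₂ 0 = H₁ᴴ * H₁ - H₂ᴴ * H₂ := by
  simp [gapGrad, logDetGrad_zero]

theorem isHermitian_gapGrad (hK : K.PosSemidef) : (gapGrad H₁ H₂ K).IsHermitian :=
  (isHermitian_logDetGrad H₁ hK).sub (isHermitian_logDetGrad H₂ hK)

theorem hasDerivAt_gap {D : Matrix n n ℂ} {x : ℝ} (h : (K + x • D).PosSemidef) :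
    HasDerivAt (fun y : ℝ => gap H₁ H₂ (K + y • D)) (gapGrad H₁ H₂ (K + x • D) * D).trace.re x := by
  rw [gapGrad, Matrix.sub_mul, Matrix.trace_sub, Complex.sub_re]
  exact (hasDerivAt_logDet H₁ h).sub (hasDerivAt_logDet H₂ h)

theorem hasDerivAt_gap_smul {Q : Matrix n n ℂ} (hQ : Q.PosSemidef) {t : ℝ} (ht : 0 ≤ t) :
    HasDerivAt (fun y : ℝ => gap H₁ H₂ (y • Q)) (gapGrad H₁ H₂ (t • Q) * Q).trace.re t := by
  have := hasDerivAt_gap (K := 0) (D := Q) H₁ H₂ (by simpa using hQ.smul ht)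
  simpa using this

theorem continuousOn_gap : ContinuousOn (gap H₁ H₂) {K | K.PosSemidef} :=
  (continuousOn_logDet H₁).sub (continuousOn_logDet H₂)

end Gap

/-! ### First-order optimality conditions -/

theorem deriv_nonpos_of_le {φ : ℝ → ℝ} {d : ℝ} (h : HasDerivAt φ d 0)
    (hle : ∀ y ∈ Set.Ioc (0 : ℝ) 1, φ y ≤ φ 0) : d ≤ 0 := by
  have h1 := h.tendsto_slope_zero_right
  refine le_of_tendsto h1 ?_
  filter_upwards [Ioc_mem_nhdsGT (zero_lt_one' ℝ)] with y hy
  rw [zero_add, smul_eq_mul]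
  exact mul_nonpos_of_nonneg_of_nonpos (inv_nonneg.2 hy.1.le) (sub_nonpos.2 (hle y hy))

section Stationary

open scoped Matrix.Norms.Frobenius

variable {n : ℕ}

theorem convex_admissible (P : ℝ) : Convex ℝ (admissible n P) := by
  intro X hX Y hY a b ha hb hab
  refine ⟨(hX.1.smul ha).add (hY.1.smul hb), ?_⟩
  simp only [Matrix.trace_add, Matrix.trace_smul, Complex.add_re, Complex.smul_re, smul_eq_mul]
  calc _ ≤ a * P + b * P :=
        add_le_add (mul_le_mul_of_nonneg_left hX.2 ha) (mul_le_mul_of_nonneg_left hY.2 hb)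
    _ = P := by rw [← add_mul, hab, one_mul]

theorem zero_mem_admissible {P : ℝ} (hP : 0 ≤ P) : (0 : Matrix (Fin n) (Fin n) ℂ) ∈ admissible n P :=
  ⟨Matrix.PosSemidef.zero, by simpa using hP⟩

theorem isClosed_posSemidef : IsClosed {X : Matrix (Fin n) (Fin n) ℂ | X.PosSemidef} := by
  simp only [Matrix.posSemidef_iff_dotProduct_mulVec, Set.ofPred_and, Set.ofPred_forall]
  refine IsClosed.inter (isClosed_eq (by fun_prop) (by fun_prop)) (isClosed_iInter fun x => ?_)
  exact isClosed_le continuous_const (by fun_prop)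

theorem isCompact_admissible (P : ℝ) : IsCompact (admissible n P) := by
  refine Metric.isCompact_of_isClosed_isBounded ?_ ?_
  · exact isClosed_posSemidef.inter (isClosed_le (f := fun X : Matrix (Fin n) (Fin n) ℂ => X.trace.re)
      (by fun_prop) continuous_const)
  · exact isBounded_iff_forall_norm_le.2 ⟨P, fun X hX => (norm_le_trace hX.1).trans hX.2⟩

/-- `Q` maximizes the linear functional `re tr (G ·)` over the positive semidefinite matrices
of trace at most one. -/
def IsTraceMax (G Q : Matrix (Fin n) (Fin n) ℂ) : Prop :=
  Q ∈ admissible n 1 ∧ ∀ Q' ∈ admissible n 1, (G * Q').trace.re ≤ (G * Q).trace.re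

/-- The feasible set is convex, so the gap has nonpositive one-sided derivative along each segment
leaving a maximizer. Only this necessary condition is available, since the gap need not be concave.
-/
theorem isTraceMax_of_isMax {r₁ r₂ : ℕ} (H₁ : Matrix (Fin r₁) (Fin n) ℂ)
    (H₂ : Matrix (Fin r₂) (Fin n) ℂ) {t : ℝ} (ht : 0 < t) {Q : Matrix (Fin n) (Fin n) ℂ}
    (hQ : Q ∈ admissible n 1)
    (hmax : ∀ Q' ∈ admissible n 1, gap H₁ H₂ (t • Q') ≤ gap H₁ H₂ (t • Q)) :
    IsTraceMax (gapGrad H₁ H₂ (t • Q)) Q := by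
  refine ⟨hQ, fun Q' hQ' => ?_⟩
  have h1 := hasDerivAt_gap (K := t • Q) (D := t • (Q' - Q)) (x := 0) H₁ H₂
    (by simpa using hQ.1.smul ht.le)
  have h2 := deriv_nonpos_of_le h1 fun y hy => by
    have h3 : t • Q + y • t • (Q' - Q) = t • (Q + y • (Q' - Q)) := by
      rw [smul_add, smul_comm]
    rw [h3, zero_smul, add_zero]
    exact hmax _ ((convex_admissible 1).add_smul_sub_mem hQ hQ' ⟨hy.1.le, hy.2⟩)
  rw [zero_smul, add_zero, Matrix.mul_smul, Matrix.mul_sub, Matrix.trace_smul, Complex.smul_re,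
    Matrix.trace_sub, Complex.sub_re, smul_eq_mul] at h2
  nlinarith

variable {G G' Q Q' : Matrix (Fin n) (Fin n) ℂ}

theorem norm_le_one_of_mem (hQ : Q ∈ admissible n 1) : ‖Q‖ ≤ 1 :=
  (norm_le_trace hQ.1).trans hQ.2

theorem IsTraceMax.trace_nonneg (h : IsTraceMax G Q) : 0 ≤ (G * Q).trace.re := by
  simpa using h.2 0 (zero_mem_admissible zero_le_one)

theorem trace_mul_vecMulVec (G : Matrix (Fin n) (Fin n) ℂ) (x : Fin n → ℂ) :
    (G * Matrix.vecMulVec x (star x)).trace = star x ⬝ᵥ G *ᵥ x := by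
  rw [Matrix.mul_vecMulVec, Matrix.trace_vecMulVec, dotProduct_comm]

/-- Dual feasibility: testing against normalized rank-one matrices bounds every Rayleigh quotient of
G by the maximum. -/
theorem IsTraceMax.posSemidef (hG : G.IsHermitian) (h : IsTraceMax G Q) :
    ((G * Q).trace.re • (1 : Matrix (Fin n) (Fin n) ℂ) - G).PosSemidef := by
  refine Matrix.PosSemidef.of_dotProduct_mulVec_nonneg ?_ fun x => ?_
  · refine Matrix.IsHermitian.sub ?_ hG
    simp [Matrix.IsHermitian, Matrix.conjTranspose_smul]
  · set μ := (G * Q).trace.re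
    have him : (star x ⬝ᵥ G *ᵥ x).im = 0 := hG.im_star_dotProduct_mulVec_self x
    have hxx : 0 ≤ star x ⬝ᵥ x := dotProduct_star_self_nonneg x
    obtain ⟨r, hr, hrx⟩ : ∃ r : ℝ, 0 ≤ r ∧ star x ⬝ᵥ x = r :=
      ⟨(star x ⬝ᵥ x).re, (Complex.nonneg_iff.1 hxx).1, by
        apply Complex.ext <;> simp [(Complex.nonneg_iff.1 hxx).2.symm]⟩
    have key : (star x ⬝ᵥ G *ᵥ x).re ≤ μ * r := by
      rcases hr.eq_or_lt with h0 | h0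
      · have : x = 0 := by
          rw [← dotProduct_star_self_eq_zero, dotProduct_comm]
          simpa [← h0] using hrx
        simp [this, ← h0]
      · have h1 := h.2 (r⁻¹ • Matrix.vecMulVec x (star x))
          ⟨(Matrix.posSemidef_vecMulVec_self_star x).smul (inv_nonneg.2 hr), by
            rw [Matrix.trace_smul, Matrix.trace_vecMulVec, dotProduct_comm, hrx]
            simp [h0.ne']⟩
        rw [Matrix.mul_smul, Matrix.trace_smul, trace_mul_vecMulVec, Complex.smul_re, smul_eq_mul,
          inv_mul_le_iff₀ h0] at h1
        linarith
    rw [Matrix.sub_mulVec, Matrix.smul_mulVec, Matrix.one_mulVec, dotProduct_sub, dotProduct_smul,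
      hrx, Complex.nonneg_iff]
    simp [him, key]

/-- Complementary slackness: with μ = tr GQ ≥ 0 and tr Q ≤ 1, the trace of (μ1 − G)Q is μ(tr Q − 1)
≤ 0, so this product of positive semidefinite matrices vanishes. -/
theorem IsTraceMax.mul_eq (hG : G.IsHermitian) (h : IsTraceMax G Q) :
    G * Q = (G * Q).trace.re • Q := by
  have h1 := mul_eq_zero_of_trace_nonpos (h.posSemidef hG) h.1.1 (by
    rw [Matrix.sub_mul, Matrix.smul_mul, Matrix.one_mul, Matrix.trace_sub, Matrix.trace_smul,
      Complex.sub_re, Complex.smul_re, smul_eq_mul]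
    nlinarith [h.1.2, h.trace_nonneg])
  rw [Matrix.sub_mul, Matrix.smul_mul, Matrix.one_mul, sub_eq_zero] at h1
  exact h1.symm

theorem IsTraceMax.trace_sub_le (h : IsTraceMax G Q) (h' : IsTraceMax G' Q') :
    (G' * Q').trace.re - (G * Q).trace.re ≤ ‖G' - G‖ := by
  have h1 := h.2 Q' h'.1
  have h2 := (le_abs_self _).trans (abs_trace_re_mul_le (G' - G) Q')
  have h3 := mul_le_mul_of_nonneg_left (norm_le_one_of_mem h'.1) (norm_nonneg (G' - G))
  rw [Matrix.sub_mul, Matrix.trace_sub, Complex.sub_re] at h2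
  linarith

theorem IsTraceMax.abs_trace_sub_le (h : IsTraceMax G Q) (h' : IsTraceMax G' Q') :
    |(G' * Q').trace.re - (G * Q).trace.re| ≤ ‖G' - G‖ :=
  abs_le.2 ⟨by linarith [h'.trace_sub_le h, norm_sub_rev G G'], h.trace_sub_le h'⟩

/-- Maximizers of nearby functionals differ, up to the distance of the functionals,
by an eigenmatrix. -/
theorem IsTraceMax.norm_mul_sub_le (hG : G.IsHermitian) (hG' : G'.IsHermitian)
    (h : IsTraceMax G Q) (h' : IsTraceMax G' Q') :
    ‖G * (Q' - Q) - (G * Q).trace.re • (Q' - Q)‖ ≤ 2 * ‖G' - G‖ := by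
  -- The equations GQ = μQ and G'Q' = μ'Q' leave only the differences μ' − μ and G' − G, each of
  -- size at most ‖G' − G‖.
  have h1 : G * (Q' - Q) - (G * Q).trace.re • (Q' - Q)
      = ((G' * Q').trace.re - (G * Q).trace.re) • Q' - (G' - G) * Q' := by
    rw [Matrix.mul_sub, smul_sub, ← h.mul_eq hG, Matrix.sub_mul, sub_smul, ← h'.mul_eq hG']
    abel
  rw [h1]
  refine (norm_sub_le _ _).trans ?_
  have h2 := mul_le_mul (h.abs_trace_sub_le h') (norm_le_one_of_mem h'.1) (norm_nonneg _) (norm_nonneg _)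
  have h3 := (Matrix.frobenius_norm_mul (G' - G) Q').trans
    (mul_le_mul_of_nonneg_left (norm_le_one_of_mem h'.1) (norm_nonneg _))
  rw [norm_smul, Real.norm_eq_abs]
  linarith

end Stationary

/-! ### Curvature at zero and expansions of the gradient -/

section Curvature

open scoped Matrix.Norms.Frobenius

variable {m m₁ m₂ n : Type*} [Fintype m] [Fintype m₁] [Fintype m₂] [Fintype n]

theorem norm_mul_mul_le (X Y Z : Matrix n n ℂ) : ‖X * Y * Z‖ ≤ ‖X‖ * ‖Y‖ * ‖Z‖ :=
  (Matrix.frobenius_norm_mul _ _).trans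
    (mul_le_mul_of_nonneg_right (Matrix.frobenius_norm_mul _ _) (norm_nonneg _))

/-- Minus the second derivative of `gap H₁ H₂` at `0`, as a bilinear form. -/
def curv (H₁ : Matrix m₁ n ℂ) (H₂ : Matrix m₂ n ℂ) (X Y : Matrix n n ℂ) : ℝ :=
  (H₁ᴴ * H₁ * X * (H₁ᴴ * H₁) * Y).trace.re - (H₂ᴴ * H₂ * X * (H₂ᴴ * H₂) * Y).trace.re

theorem curv_comm (H₁ : Matrix m₁ n ℂ) (H₂ : Matrix m₂ n ℂ) (X Y : Matrix n n ℂ) :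
    curv H₁ H₂ X Y = curv H₁ H₂ Y X := by
  have h : ∀ A : Matrix n n ℂ, (A * X * A * Y).trace = (A * Y * A * X).trace := fun A => by
    rw [Matrix.mul_assoc (A * X), Matrix.trace_mul_comm]
    simp only [Matrix.mul_assoc]
  rw [curv, curv, h, h]

theorem curv_sub_right (H₁ : Matrix m₁ n ℂ) (H₂ : Matrix m₂ n ℂ) (X Y Z : Matrix n n ℂ) :
    curv H₁ H₂ X (Y - Z) = curv H₁ H₂ X Y - curv H₁ H₂ X Z := by
  simp only [curv, Matrix.mul_sub, Matrix.trace_sub, Complex.sub_re]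
  ring

theorem curv_sub_self (H₁ : Matrix m₁ n ℂ) (H₂ : Matrix m₂ n ℂ) (X Y : Matrix n n ℂ) :
    curv H₁ H₂ (Y - X) (Y - X) = curv H₁ H₂ Y Y - 2 * curv H₁ H₂ X Y + curv H₁ H₂ X X := by
  rw [curv_sub_right, curv_comm _ _ (Y - X) Y, curv_comm _ _ (Y - X) X, curv_sub_right,
    curv_sub_right, curv_comm _ _ Y X]
  ring

/-- The form `curv` is positive definite on matrices supported in an eigenspace of
`H₁† H₁ - H₂† H₂` for a positive eigenvalue, up to the defect of being an eigenmatrix. -/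
theorem le_curv_self (H₁ : Matrix m₁ n ℂ) (H₂ : Matrix m₂ n ℂ) {D : Matrix n n ℂ}
    (hD : D.IsHermitian) {r : ℝ} (hr : 0 ≤ r) :
    r ^ 2 * ‖D‖ ^ 2 - 2 * (‖H₁ᴴ * H₁‖ * ‖D‖) * ‖(H₁ᴴ * H₁ - H₂ᴴ * H₂) * D - r • D‖
      - ‖(H₁ᴴ * H₁ - H₂ᴴ * H₂) * D - r • D‖ ^ 2 ≤ curv H₁ H₂ D D := by
  set A := H₁ᴴ * H₁
  set B := H₂ᴴ * H₂ with hB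
  set X := (A - B) * D - r • D with hX
  have hY : A * D = (B * D + r • D) + X := by rw [hX, Matrix.sub_mul]; abel
  clear_value X
  -- The trace of the square of BD + rD = AD − X is computed in two ways. The term 2r tr(BD²) is
  -- nonnegative and is dropped below.
  have e1 : ((A * D) * (A * D)).trace.re = ((B * D) * (B * D)).trace.re
      + 2 * r * (B * (D * D)).trace.re + r ^ 2 * ‖D‖ ^ 2 + 2 * (A * D * X).trace.re
      - (X * X).trace.re := by
    have h1 : ((B * D + r • D) * (B * D + r • D)).trace
        = ((A * D) * (A * D)).trace - 2 * (A * D * X).trace + (X * X).trace := by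
      rw [eq_sub_of_add_eq hY.symm, Matrix.sub_mul, Matrix.mul_sub, Matrix.mul_sub,
        Matrix.trace_sub, Matrix.trace_sub, Matrix.trace_sub, Matrix.trace_mul_comm X (A * D)]
      ring
    have h2 : ((B * D + r • D) * (B * D + r • D)).trace
        = ((B * D) * (B * D)).trace + 2 * r * (B * (D * D)).trace + r ^ 2 * (D * D).trace := by
      have h3 : (D * (B * D)).trace = (B * (D * D)).trace := by
        rw [Matrix.trace_mul_comm, Matrix.mul_assoc]
      simp only [Matrix.add_mul, Matrix.mul_add, Matrix.smul_mul, Matrix.mul_smul,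
        Matrix.trace_add, Matrix.trace_smul, h3, Complex.real_smul]
      rw [Matrix.mul_assoc B D D]
      ring
    have h4 := congrArg Complex.re (h1.symm.trans h2)
    have h5 := trace_mul_self_re hD
    simp only [Complex.sub_re, Complex.add_re, Complex.mul_re, ← Complex.ofReal_pow,
      Complex.ofReal_re, Complex.ofReal_im, Complex.re_ofNat, Complex.im_ofNat,
      Complex.mul_im, h5] at h4
    linarith
  have e2 : 0 ≤ (B * (D * D)).trace.re :=
    trace_mul_nonneg (Matrix.posSemidef_conjTranspose_mul_self H₂) (by
      have := Matrix.posSemidef_conjTranspose_mul_self D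
      rwa [hD.eq] at this)
  have e3 : |(A * D * X).trace.re| ≤ ‖A‖ * ‖D‖ * ‖X‖ := (abs_trace_re_mul_le _ _).trans
    (mul_le_mul_of_nonneg_right (Matrix.frobenius_norm_mul _ _) (norm_nonneg _))
  have e4 := abs_trace_re_mul_le X X
  have e5 : curv H₁ H₂ D D = ((A * D) * (A * D)).trace.re - ((B * D) * (B * D)).trace.re := by
    rw [curv]; simp only [Matrix.mul_assoc, A, B]
  rw [e5, e1]
  nlinarith [mul_nonneg hr e2, (abs_le.1 e3).1, (abs_le.1 e4).2]

variable [DecidableEq m] [DecidableEq m₁] [DecidableEq m₂]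
variable (H : Matrix m n ℂ) (H₁ : Matrix m₁ n ℂ) (H₂ : Matrix m₂ n ℂ) {K K' Q Q' : Matrix n n ℂ}
  {a s t : ℝ}

theorem norm_logDetGrad_sub_gram_le (hK : K.PosSemidef) (ha : ‖Hᴴ * H‖ ≤ a)
    (hKa : ‖K‖ * a ≤ 1 / 2) : ‖logDetGrad H K - Hᴴ * H‖ ≤ 2 * a ^ 2 * ‖K‖ := by
  have h := norm_logDetGrad_sub_le H hK Matrix.PosSemidef.zero
  rw [logDetGrad_zero, sub_zero] at h
  have h0 := (norm_nonneg _).trans ha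
  refine h.trans ?_
  calc _ ≤ 2 * a * ‖K‖ * a := by gcongr; exact norm_logDetGrad_le H hK ha hKa
    _ = _ := by ring

theorem norm_logDetGrad_sub_le_of_le (hK : K.PosSemidef) (hK' : K'.PosSemidef)
    (ha : ‖Hᴴ * H‖ ≤ a) (hKa : ‖K‖ * a ≤ 1 / 2) (hKa' : ‖K'‖ * a ≤ 1 / 2) :
    ‖logDetGrad H K - logDetGrad H K'‖ ≤ 4 * a ^ 2 * ‖K - K'‖ := by
  have h0 := (norm_nonneg _).trans ha
  refine (norm_logDetGrad_sub_le H hK hK').trans ?_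
  calc _ ≤ 2 * a * ‖K - K'‖ * (2 * a) := by
        gcongr
        · exact norm_logDetGrad_le H hK ha hKa
        · exact norm_logDetGrad_le H hK' ha hKa'
    _ = _ := by ring

/-- With A = H†H and G the gradient at K, the remainder is exactly (A − G)KA, and A − G is itself of
first order in K. -/
theorem norm_logDetGrad_sub_gram_add_le (hK : K.PosSemidef) (ha : ‖Hᴴ * H‖ ≤ a)
    (hKa : ‖K‖ * a ≤ 1 / 2) :
    ‖logDetGrad H K - Hᴴ * H + Hᴴ * H * K * (Hᴴ * H)‖ ≤ 2 * a ^ 3 * ‖K‖ ^ 2 := by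
  have h0 := (norm_nonneg _).trans ha
  have h := logDetGrad_sub H hK Matrix.PosSemidef.zero
  rw [logDetGrad_zero, zero_sub, Matrix.mul_neg, Matrix.neg_mul] at h
  rw [h, ← sub_eq_neg_add, ← Matrix.sub_mul, ← Matrix.sub_mul]
  refine (norm_mul_mul_le _ _ _).trans ?_
  rw [norm_sub_rev]
  calc _ ≤ 2 * a ^ 2 * ‖K‖ * ‖K‖ * a := by
        gcongr; exact norm_logDetGrad_sub_gram_le H hK ha hKa
    _ = _ := by ring

theorem norm_smul_mul_le (ht : 0 ≤ t) (ha : 0 ≤ a) (hta : t * a ≤ 1 / 2) (hQ : ‖Q‖ ≤ 1) :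
    ‖t • Q‖ * a ≤ 1 / 2 := by
  rw [norm_smul, Real.norm_of_nonneg ht]
  calc t * ‖Q‖ * a ≤ t * 1 * a := by gcongr
    _ ≤ 1 / 2 := by rwa [mul_one]

/-- First-order expansion, along the difference of two matrices, of the gradient of `logDet H`. -/
theorem abs_trace_logDetGrad_sub_add_le (hQ : Q.PosSemidef) (hQ' : Q'.PosSemidef)
    (h1 : ‖Q‖ ≤ 1) (h1' : ‖Q'‖ ≤ 1) (ha : ‖Hᴴ * H‖ ≤ a) (ht : 0 ≤ t) (hs : 0 ≤ s)
    (hta : t * a ≤ 1 / 2) (hsa : s * a ≤ 1 / 2) :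
    |((logDetGrad H (s • Q') - logDetGrad H (t • Q)) * (Q' - Q)).trace.re
      + t * (Hᴴ * H * (Q' - Q) * (Hᴴ * H) * (Q' - Q)).trace.re|
      ≤ 4 * a ^ 3 * (t * (t + s)) * ‖Q' - Q‖ ^ 2 + 4 * a ^ 2 * |s - t| * ‖Q' - Q‖ := by
  have h0 := (norm_nonneg _).trans ha
  have hK := hQ.smul ht
  have hK' := hQ'.smul hs
  have hKa := norm_smul_mul_le ht h0 hta h1
  have hKa' := norm_smul_mul_le hs h0 hsa h1'
  have hG := norm_logDetGrad_le H hK ha hKa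
  have hG' := norm_logDetGrad_le H hK' ha hKa'
  have hGA := norm_logDetGrad_sub_gram_le H hK ha hKa
  have hGA' := norm_logDetGrad_sub_gram_le H hK' ha hKa'
  have hn : ‖t • Q‖ ≤ t := by
    rw [norm_smul, Real.norm_of_nonneg ht]; exact mul_le_of_le_one_right ht h1
  have hn' : ‖s • Q'‖ ≤ s := by
    rw [norm_smul, Real.norm_of_nonneg hs]; exact mul_le_of_le_one_right hs h1'
  have hsub := logDetGrad_sub H hK' hK
  set G := logDetGrad H (t • Q)
  set G' := logDetGrad H (s • Q')
  set A := Hᴴ * H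
  set D := Q' - Q with hD
  -- Here G' − G = −G'(tD + (s − t)Q')G. Replacing G' and G by A in the first term costs O(t + s),
  -- and the second term is O(|s − t|).
  have e1 : (G' - G) * D + (t : ℂ) • (A * D * A * D)
      = (t : ℂ) • (((A - G') * D * A + G' * D * (A - G)) * D) - ((s - t : ℝ) : ℂ) • (G' * Q' * G * D) := by
    have h2 : t • Q - s • Q' = -((t : ℂ) • D + ((s - t : ℝ) : ℂ) • Q') := by
      rw [hD]
      ext i j
      simp
      ring
    rw [hsub, h2]
    simp only [Matrix.mul_neg, Matrix.neg_mul, Matrix.mul_add, Matrix.add_mul, Matrix.mul_smul,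
      Matrix.smul_mul, Matrix.sub_mul, Matrix.mul_sub, smul_add, smul_sub]
    abel
  have e2 : ((G' - G) * D).trace.re + t * (A * D * A * D).trace.re
      = t * (((A - G') * D * A + G' * D * (A - G)) * D).trace.re
        - (s - t) * (G' * Q' * G * D).trace.re := by
    have h3 := congrArg (fun X => (Matrix.trace X).re) e1
    simpa only [Matrix.trace_add, Matrix.trace_sub, Matrix.trace_smul, Complex.add_re,
      Complex.sub_re, smul_eq_mul, Complex.re_ofReal_mul] using h3
  have e3 : |(((A - G') * D * A + G' * D * (A - G)) * D).trace.re|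
      ≤ 4 * a ^ 3 * (t + s) * ‖D‖ ^ 2 := by
    refine (abs_trace_re_mul_le _ _).trans ?_
    rw [sq, ← mul_assoc]
    refine mul_le_mul_of_nonneg_right ?_ (norm_nonneg _)
    refine (norm_add_le _ _).trans ?_
    calc _ ≤ ‖A - G'‖ * ‖D‖ * ‖A‖ + ‖G'‖ * ‖D‖ * ‖A - G‖ :=
          add_le_add (norm_mul_mul_le _ _ _) (norm_mul_mul_le _ _ _)
      _ ≤ (2 * a ^ 2 * s) * ‖D‖ * a + (2 * a) * ‖D‖ * (2 * a ^ 2 * t) := by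
          rw [norm_sub_rev A, norm_sub_rev A]
          gcongr
          · exact hGA'.trans (by gcongr)
          · exact hGA.trans (by gcongr)
      _ ≤ 4 * a ^ 3 * (t + s) * ‖D‖ := by
          have : 0 ≤ a ^ 3 * s * ‖D‖ := by positivity
          nlinarith
  have e4 : |(G' * Q' * G * D).trace.re| ≤ 4 * a ^ 2 * ‖D‖ := by
    refine (abs_trace_re_mul_le _ _).trans ?_
    refine mul_le_mul_of_nonneg_right ((norm_mul_mul_le _ _ _).trans ?_) (norm_nonneg _)
    calc _ ≤ 2 * a * 1 * (2 * a) := by gcongr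
      _ = _ := by ring
  rw [e2]
  refine (abs_sub _ _).trans ?_
  rw [abs_mul, abs_mul, abs_of_nonneg ht]
  calc _ ≤ t * (4 * a ^ 3 * (t + s) * ‖D‖ ^ 2) + |s - t| * (4 * a ^ 2 * ‖D‖) := by gcongr
    _ = _ := by ring

variable {H₁ H₂}

theorem norm_gapGrad_sub_gram_le (hK : K.PosSemidef) (ha₁ : ‖H₁ᴴ * H₁‖ ≤ a) (ha₂ : ‖H₂ᴴ * H₂‖ ≤ a)
    (hKa : ‖K‖ * a ≤ 1 / 2) :
    ‖gapGrad H₁ H₂ K - (H₁ᴴ * H₁ - H₂ᴴ * H₂)‖ ≤ 4 * a ^ 2 * ‖K‖ := by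
  have h1 := norm_logDetGrad_sub_gram_le H₁ hK ha₁ hKa
  have h2 := norm_logDetGrad_sub_gram_le H₂ hK ha₂ hKa
  rw [gapGrad, sub_sub_sub_comm]
  linarith [norm_sub_le (logDetGrad H₁ K - H₁ᴴ * H₁) (logDetGrad H₂ K - H₂ᴴ * H₂)]

theorem norm_gapGrad_sub_le (hK : K.PosSemidef) (hK' : K'.PosSemidef)
    (ha₁ : ‖H₁ᴴ * H₁‖ ≤ a) (ha₂ : ‖H₂ᴴ * H₂‖ ≤ a)
    (hKa : ‖K‖ * a ≤ 1 / 2) (hKa' : ‖K'‖ * a ≤ 1 / 2) :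
    ‖gapGrad H₁ H₂ K - gapGrad H₁ H₂ K'‖ ≤ 8 * a ^ 2 * ‖K - K'‖ := by
  have h1 := norm_logDetGrad_sub_le_of_le H₁ hK hK' ha₁ hKa hKa'
  have h2 := norm_logDetGrad_sub_le_of_le H₂ hK hK' ha₂ hKa hKa'
  rw [gapGrad, gapGrad, sub_sub_sub_comm]
  linarith [norm_sub_le (logDetGrad H₁ K - logDetGrad H₁ K') (logDetGrad H₂ K - logDetGrad H₂ K')]

theorem norm_gapGrad_sub_gram_add_le (hK : K.PosSemidef) (ha₁ : ‖H₁ᴴ * H₁‖ ≤ a)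
    (ha₂ : ‖H₂ᴴ * H₂‖ ≤ a) (hKa : ‖K‖ * a ≤ 1 / 2) :
    ‖gapGrad H₁ H₂ K - (H₁ᴴ * H₁ - H₂ᴴ * H₂)
      + (H₁ᴴ * H₁ * K * (H₁ᴴ * H₁) - H₂ᴴ * H₂ * K * (H₂ᴴ * H₂))‖ ≤ 4 * a ^ 3 * ‖K‖ ^ 2 := by
  have h1 := norm_logDetGrad_sub_gram_add_le H₁ hK ha₁ hKa
  have h2 := norm_logDetGrad_sub_gram_add_le H₂ hK ha₂ hKa
  rw [gapGrad, sub_sub_sub_comm, sub_add_sub_comm]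
  exact (norm_sub_le _ _).trans (by linarith)

theorem norm_gapGrad_le (hK : K.PosSemidef) (ha₁ : ‖H₁ᴴ * H₁‖ ≤ a) (ha₂ : ‖H₂ᴴ * H₂‖ ≤ a)
    (hKa : ‖K‖ * a ≤ 1 / 2) : ‖gapGrad H₁ H₂ K‖ ≤ 4 * a := by
  have h1 := norm_logDetGrad_le H₁ hK ha₁ hKa
  have h2 := norm_logDetGrad_le H₂ hK ha₂ hKa
  exact (norm_sub_le _ _).trans (by linarith)

end Curvature

/-- Here x is the defect of being an eigenmatrix. One factor of x² is estimated by the crude bound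
`h1`, so that the fine bound y enters only linearly. -/
theorem sub_le_of_quadratic_bound {a b r d x y c : ℝ} (ha : 0 ≤ a) (hr : 0 ≤ r) (hd : 0 ≤ d)
    (hx : 0 ≤ x) (hb : b ≤ a) (h1 : x ≤ (2 * a + r) * d) (h2 : x ≤ y)
    (h : r ^ 2 * d ^ 2 - 2 * (b * d) * x - x ^ 2 ≤ c) :
    r ^ 2 * d ^ 2 - (4 * a + r) * d * y ≤ c := by
  have e1 : (4 * a + r) * d * x ≤ (4 * a + r) * d * y := by gcongr
  have e2 : x * x ≤ (2 * a + r) * d * x := by gcongr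
  have e3 : 2 * (b * d) * x ≤ 2 * (a * d) * x := by gcongr
  linarith

/-- The two bounds on the curvature c are combined and divided by d. The error proportional to t d
has coefficient at most r²/2 by `hts` and is absorbed on the left, leaving a multiple of w, which
will be |s − t|. -/
theorem mul_le_of_curvature_bounds {a r d t s w c : ℝ} (ha : 1 ≤ a) (hr : 0 < r) (hd : 0 ≤ d)
    (ht : 0 < t) (ht1 : t ≤ 1) (hs : 0 < s) (hw : 0 ≤ w)
    (hts : (24 * a ^ 2 * (4 * a + r) + 8 * a ^ 3) * (t + s) ≤ r ^ 2 / 2)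
    (h1 : r ^ 2 * d ^ 2 - (4 * a + r) * d * (24 * a ^ 2 * (t * d + w)) ≤ c)
    (h2 : t * c ≤ 8 * a ^ 3 * (t * (t + s)) * d ^ 2 + 8 * a ^ 2 * w * d) :
    t * d ≤ 2 * (24 * a ^ 2 * (4 * a + r) + 8 * a ^ 3) / r ^ 2 * w := by
  have h0 : 0 ≤ a := by linarith
  obtain ⟨N, hN⟩ : ∃ N, N = 24 * a ^ 2 * (4 * a + r) := ⟨_, rfl⟩
  have hN0 : 0 ≤ N := by rw [hN]; positivity
  rw [← hN] at hts ⊢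
  have hfin : r ^ 2 * (t * d) * d ≤ ((N + 8 * a ^ 3) * (t + s) * (t * d) + (N + 8 * a ^ 3) * w) * d := by
    have e1 := mul_le_mul_of_nonneg_left h1 ht.le
    have e2 : 0 ≤ N * (t * s) * d ^ 2 := by positivity
    have e3 : N * (t * w) * d ≤ N * (1 * w) * d := by gcongr
    have e4 : 8 * a ^ 2 * w * d ≤ 8 * a ^ 3 * w * d := by
      gcongr
      norm_num
    have e5 : t * (r ^ 2 * d ^ 2 - (4 * a + r) * d * (24 * a ^ 2 * (t * d + w)))
        = r ^ 2 * (t * d) * d - N * (t * t) * d ^ 2 - N * (t * w) * d := by rw [hN]; ring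
    linarith
  rcases hd.eq_or_lt with hd0 | hd0
  · rw [← hd0, mul_zero]
    positivity
  · have e1 := le_of_mul_le_mul_right hfin hd0
    have e2 : (N + 8 * a ^ 3) * (t + s) * (t * d) ≤ r ^ 2 / 2 * (t * d) := by gcongr
    rw [div_mul_eq_mul_div, le_div_iff₀ (by positivity)]
    linarith

/-! ### Lipschitz dependence of the maximizers on the power -/

section Quantitative

open scoped Matrix.Norms.Frobenius

variable {n r₁ r₂ : ℕ} {H₁ : Matrix (Fin r₁) (Fin n) ℂ} {H₂ : Matrix (Fin r₂) (Fin n) ℂ}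

theorem smul_mem_bound {Q : Matrix (Fin n) (Fin n) ℂ} (hQ : Q ∈ admissible n 1) {a t : ℝ}
    (ha : 0 ≤ a) (ht : 0 ≤ t) (hta : t * a ≤ 1 / 2) :
    (t • Q).PosSemidef ∧ ‖t • Q‖ * a ≤ 1 / 2 ∧ ‖t • Q‖ ≤ t :=
  ⟨hQ.1.smul ht, norm_smul_mul_le ht ha hta (norm_le_one_of_mem hQ), by
    rw [norm_smul, Real.norm_of_nonneg ht]
    exact mul_le_of_le_one_right ht (norm_le_one_of_mem hQ)⟩

/-- Maximizers at nearby powers are close to each other. -/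
theorem mul_norm_sub_le_of_isTraceMax {a r t s : ℝ} (ha : 1 ≤ a) (ha₁ : ‖H₁ᴴ * H₁‖ ≤ a)
    (ha₂ : ‖H₂ᴴ * H₂‖ ≤ a) (hr : 0 < r) {Q₀ Q Q' : Matrix (Fin n) (Fin n) ℂ}
    (h₀ : IsTraceMax (H₁ᴴ * H₁ - H₂ᴴ * H₂) Q₀)
    (hr₀ : ((H₁ᴴ * H₁ - H₂ᴴ * H₂) * Q₀).trace.re = r)
    (ht : 0 < t) (hs : 0 < s) (ht1 : t ≤ 1) (hta : t * a ≤ 1 / 2) (hsa : s * a ≤ 1 / 2)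
    (hts : (24 * a ^ 2 * (4 * a + r) + 8 * a ^ 3) * (t + s) ≤ r ^ 2 / 2)
    (hQ : IsTraceMax (gapGrad H₁ H₂ (t • Q)) Q) (hQ' : IsTraceMax (gapGrad H₁ H₂ (s • Q')) Q') :
    t * ‖Q' - Q‖ ≤ 2 * (24 * a ^ 2 * (4 * a + r) + 8 * a ^ 3) / r ^ 2 * |s - t| := by
  have h0 : 0 ≤ a := by linarith
  obtain ⟨p, b, c⟩ := smul_mem_bound hQ.1 h0 ht.le hta
  obtain ⟨p', b', c'⟩ := smul_mem_bound hQ'.1 h0 hs.le hsa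
  have hgsub := norm_gapGrad_sub_le p' p ha₁ ha₂ b' b
  have hgΦ := norm_gapGrad_sub_gram_le p ha₁ ha₂ b
  have e₁ := abs_trace_logDetGrad_sub_add_le H₁ hQ.1.1 hQ'.1.1 (norm_le_one_of_mem hQ.1)
    (norm_le_one_of_mem hQ'.1) ha₁ ht.le hs.le hta hsa
  have e₂ := abs_trace_logDetGrad_sub_add_le H₂ hQ.1.1 hQ'.1.1 (norm_le_one_of_mem hQ.1)
    (norm_le_one_of_mem hQ'.1) ha₂ ht.le hs.le hta hsa
  have hX := hQ.norm_mul_sub_le (isHermitian_gapGrad H₁ H₂ p) (isHermitian_gapGrad H₁ H₂ p') hQ'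
  have hμ := h₀.abs_trace_sub_le hQ
  have hcurv := le_curv_self H₁ H₂ (hQ'.1.1.isHermitian.sub hQ.1.1.isHermitian) hr.le
  -- Each maximizer is a competitor for the other's linear functional; the two inequalities are
  -- added.
  have hmono : 0 ≤ ((gapGrad H₁ H₂ (s • Q') - gapGrad H₁ H₂ (t • Q)) * (Q' - Q)).trace.re := by
    have h1 := hQ.2 Q' hQ'.1
    have h2 := hQ'.2 Q hQ.1
    simp only [Matrix.sub_mul, Matrix.mul_sub, Matrix.trace_sub, Complex.sub_re]
    linarith
  have hdiff : ‖s • Q' - t • Q‖ ≤ t * ‖Q' - Q‖ + |s - t| := by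
    have h1 : s • Q' - t • Q = t • (Q' - Q) + (s - t) • Q' := by
      rw [smul_sub, sub_smul]; abel
    rw [h1]
    refine (norm_add_le _ _).trans ?_
    rw [norm_smul, norm_smul, Real.norm_of_nonneg ht.le, Real.norm_eq_abs]
    gcongr
    exact mul_le_of_le_one_right (abs_nonneg _) (norm_le_one_of_mem hQ'.1)
  have hadd : ((gapGrad H₁ H₂ (s • Q') - gapGrad H₁ H₂ (t • Q)) * (Q' - Q)).trace.re
      = ((logDetGrad H₁ (s • Q') - logDetGrad H₁ (t • Q)) * (Q' - Q)).trace.re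
        - ((logDetGrad H₂ (s • Q') - logDetGrad H₂ (t • Q)) * (Q' - Q)).trace.re := by
    simp only [gapGrad, Matrix.sub_mul, Matrix.trace_sub, Complex.sub_re]
    ring
  have hcdef : curv H₁ H₂ (Q' - Q) (Q' - Q)
      = (H₁ᴴ * H₁ * (Q' - Q) * (H₁ᴴ * H₁) * (Q' - Q)).trace.re
        - (H₂ᴴ * H₂ * (Q' - Q) * (H₂ᴴ * H₂) * (Q' - Q)).trace.re := rfl
  have hΦ : ‖H₁ᴴ * H₁ - H₂ᴴ * H₂‖ ≤ 2 * a := (norm_sub_le _ _).trans (by linarith)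
  rw [hr₀] at hμ
  set Φ := H₁ᴴ * H₁ - H₂ᴴ * H₂
  set g := gapGrad H₁ H₂ (t • Q)
  set g' := gapGrad H₁ H₂ (s • Q')
  set D := Q' - Q
  clear_value Φ g g' D
  have hd := norm_nonneg D
  -- 24 = 2·8 + 2·4: twice the Lipschitz bound of the gradient, and twice the distance from g to Φ,
  -- once for the matrix and once for its multiplier.
  have hXle : ‖Φ * D - r • D‖ ≤ 24 * a ^ 2 * (t * ‖D‖ + |s - t|) := by
    have h1 : Φ * D - r • D
        = (g * D - (g * Q).trace.re • D) - (g - Φ) * D + ((g * Q).trace.re - r) • D := by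
      rw [sub_smul, Matrix.sub_mul g]; abel
    have h2 : ‖Φ * D - r • D‖ ≤ 2 * ‖g' - g‖ + ‖g - Φ‖ * ‖D‖ + ‖g - Φ‖ * ‖D‖ := by
      rw [h1]
      refine (norm_add_le _ _).trans (add_le_add ((norm_sub_le _ _).trans
        (add_le_add hX (Matrix.frobenius_norm_mul _ _))) ?_)
      rw [norm_smul, Real.norm_eq_abs]
      gcongr
    have h3 : ‖g' - g‖ ≤ 8 * a ^ 2 * (t * ‖D‖ + |s - t|) := hgsub.trans (by gcongr)
    have h4 : ‖g - Φ‖ * ‖D‖ ≤ 4 * a ^ 2 * t * ‖D‖ := by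
      gcongr; exact hgΦ.trans (by gcongr)
    have : 0 ≤ a ^ 2 * |s - t| := by positivity
    nlinarith
  have hXle' : ‖Φ * D - r • D‖ ≤ (2 * a + r) * ‖D‖ := by
    refine (norm_sub_le _ _).trans ?_
    rw [norm_smul, Real.norm_of_nonneg hr.le, add_mul]
    gcongr
    refine (Matrix.frobenius_norm_mul _ _).trans ?_
    gcongr
  have hcurv' : r ^ 2 * ‖D‖ ^ 2 - (4 * a + r) * ‖D‖ * (24 * a ^ 2 * (t * ‖D‖ + |s - t|))
      ≤ curv H₁ H₂ D D := by
    exact sub_le_of_quadratic_bound h0 hr.le hd (norm_nonneg _) ha₁ hXle' hXle hcurv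
  have hmain : t * curv H₁ H₂ D D
      ≤ 8 * a ^ 3 * (t * (t + s)) * ‖D‖ ^ 2 + 8 * a ^ 2 * |s - t| * ‖D‖ := by
    rw [hcdef, mul_sub]
    rw [hadd] at hmono
    linarith [(abs_le.1 e₁).2, (abs_le.1 e₂).1]
  exact mul_le_of_curvature_bounds ha hr hd ht ht1 hs (abs_nonneg _) hts hcurv' hmain

/-- Second-order Taylor estimate in the power for a fixed direction. -/
theorem abs_gap_smul_sub_le {a t s : ℝ} (ha₁ : ‖H₁ᴴ * H₁‖ ≤ a)
    (ha₂ : ‖H₂ᴴ * H₂‖ ≤ a) {Q : Matrix (Fin n) (Fin n) ℂ} (hQ : Q ∈ admissible n 1)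
    (ht : 0 ≤ t) (hs : 0 ≤ s) (hta : t * a ≤ 1 / 2) (hsa : s * a ≤ 1 / 2) :
    |gap H₁ H₂ (t • Q) - gap H₁ H₂ (s • Q) - (gapGrad H₁ H₂ (s • Q) * Q).trace.re * (t - s)|
      ≤ 8 * a ^ 2 * (t - s) ^ 2 := by
  have h0 := (norm_nonneg _).trans ha₁
  obtain ⟨p, b, c⟩ := smul_mem_bound hQ h0 hs hsa
  set ψ := (gapGrad H₁ H₂ (s • Q) * Q).trace.re
  have hmem : ∀ x ∈ Set.uIcc s t, 0 ≤ x ∧ x * a ≤ 1 / 2 ∧ |x - s| ≤ |t - s| := by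
    intro x hx
    refine ⟨(le_min hs ht).trans hx.1, ?_, ?_⟩
    · rcases le_total s t with h | h
      · rw [Set.uIcc_of_le h] at hx
        exact (mul_le_mul_of_nonneg_right hx.2 h0).trans hta
      · rw [Set.uIcc_of_ge h] at hx
        exact (mul_le_mul_of_nonneg_right hx.2 h0).trans hsa
    · exact Set.abs_sub_left_of_mem_uIcc hx
  have hder : ∀ x ∈ Set.uIcc s t, HasDerivWithinAt (fun y => gap H₁ H₂ (y • Q) - ψ * y)
      ((gapGrad H₁ H₂ (x • Q) * Q).trace.re - ψ) (Set.uIcc s t) x := fun x hx => by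
    have h1 := (hasDerivAt_gap_smul H₁ H₂ hQ.1 (hmem x hx).1).sub
      ((hasDerivAt_id x).const_mul ψ)
    rw [mul_one] at h1
    exact h1.hasDerivWithinAt
  have hbound : ∀ x ∈ Set.uIcc s t,
      ‖(gapGrad H₁ H₂ (x • Q) * Q).trace.re - ψ‖ ≤ 8 * a ^ 2 * |t - s| := fun x hx => by
    obtain ⟨hx0, hxa, hxs⟩ := hmem x hx
    obtain ⟨p', b', c'⟩ := smul_mem_bound hQ h0 hx0 hxa
    have h1 := abs_trace_re_mul_le (gapGrad H₁ H₂ (x • Q) - gapGrad H₁ H₂ (s • Q)) Q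
    rw [Matrix.sub_mul, Matrix.trace_sub, Complex.sub_re] at h1
    have h2 := norm_gapGrad_sub_le p' p ha₁ ha₂ b' b
    rw [← sub_smul, norm_smul, Real.norm_eq_abs] at h2
    rw [Real.norm_eq_abs]
    have hq := norm_le_one_of_mem hQ
    calc _ ≤ ‖gapGrad H₁ H₂ (x • Q) - gapGrad H₁ H₂ (s • Q)‖ * ‖Q‖ := h1
      _ ≤ (8 * a ^ 2 * (|x - s| * ‖Q‖)) * ‖Q‖ := by gcongr
      _ ≤ (8 * a ^ 2 * (|t - s| * 1)) * 1 := by gcongr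
      _ = _ := by ring
  have h2 := Convex.norm_image_sub_le_of_norm_hasDerivWithin_le hder hbound
    (convex_uIcc s t) Set.left_mem_uIcc Set.right_mem_uIcc
  rw [Real.norm_eq_abs, Real.norm_eq_abs, mul_assoc, abs_mul_abs_self] at h2
  calc _ = |gap H₁ H₂ (t • Q) - ψ * t - (gap H₁ H₂ (s • Q) - ψ * s)| := by congr 1; ring
    _ ≤ _ := h2.trans (by rw [sq (t - s)])

end Quantitative

/-! ### Regularity of the value function -/

section Value

open scoped Matrix.Norms.Frobenius
open Filter Topology

theorem hasDerivWithinAt_of_abs_sub_le {f : ℝ → ℝ} {d x L : ℝ} {S : Set ℝ}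
    (h : ∀ᶠ y in 𝓝[S] x, |f y - f x - d * (y - x)| ≤ L * (y - x) ^ 2) :
    HasDerivWithinAt f d S x := by
  rw [hasDerivWithinAt_iff_isLittleO]
  have h1 : (fun y => f y - f x - (y - x) • d) =O[𝓝[S] x] fun y => ‖y - x‖ ^ 2 := by
    refine Asymptotics.IsBigO.of_bound L ?_
    filter_upwards [h] with y hy
    rw [smul_eq_mul, mul_comm (y - x) d]
    simpa using hy
  exact h1.trans_isLittleO
    ((Asymptotics.isLittleO_pow_sub_sub x one_lt_two).mono nhdsWithin_le_nhds)

variable {n r₁ r₂ : ℕ} (H₁ : Matrix (Fin r₁) (Fin n) ℂ) (H₂ : Matrix (Fin r₂) (Fin n) ℂ)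

/-- The largest value of `gap H₁ H₂` over the positive semidefinite matrices of trace
at most `t`. -/
def gapSup (t : ℝ) : ℝ := sSup ((fun Q => gap H₁ H₂ (t • Q)) '' admissible n 1)

theorem exists_forall_gap_le {t : ℝ} (ht : 0 ≤ t) :
    ∃ Q ∈ admissible n 1, ∀ Q' ∈ admissible n 1, gap H₁ H₂ (t • Q') ≤ gap H₁ H₂ (t • Q) :=
  (isCompact_admissible 1).exists_isMaxOn ⟨0, zero_mem_admissible zero_le_one⟩
    ((continuousOn_gap H₁ H₂).comp (f := fun Q : Matrix (Fin n) (Fin n) ℂ => t • Q) (by fun_prop)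
      fun _ hQ => hQ.1.smul ht)

variable {H₁ H₂}

theorem isGreatest_gapSup {t : ℝ} (ht : 0 ≤ t) :
    IsGreatest ((fun Q => gap H₁ H₂ (t • Q)) '' admissible n 1) (gapSup H₁ H₂ t) := by
  obtain ⟨Q, hQ, hmax⟩ := exists_forall_gap_le H₁ H₂ ht
  have h : IsGreatest ((fun Q => gap H₁ H₂ (t • Q)) '' admissible n 1) (gap H₁ H₂ (t • Q)) :=
    ⟨⟨Q, hQ, rfl⟩, by rintro _ ⟨Q', hQ', rfl⟩; exact hmax Q' hQ'⟩
  rwa [gapSup, h.csSup_eq]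

theorem gap_le_gapSup {t : ℝ} (ht : 0 ≤ t) {Q : Matrix (Fin n) (Fin n) ℂ}
    (hQ : Q ∈ admissible n 1) : gap H₁ H₂ (t • Q) ≤ gapSup H₁ H₂ t :=
  (isGreatest_gapSup ht).2 ⟨Q, hQ, rfl⟩

theorem gapSup_zero : gapSup H₁ H₂ 0 = 0 := by
  obtain ⟨Q, -, hQ⟩ := (isGreatest_gapSup (H₁ := H₁) (H₂ := H₂) le_rfl).1
  rw [← hQ]
  simp [gap_zero]

theorem abs_trace_gapGrad_sub_add_le {a r t : ℝ} (ha₁ : ‖H₁ᴴ * H₁‖ ≤ a) (ha₂ : ‖H₂ᴴ * H₂‖ ≤ a)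
    (ht : 0 ≤ t) (hta : t * a ≤ 1 / 2) {Q P : Matrix (Fin n) (Fin n) ℂ} (hQ : Q ∈ admissible n 1)
    (hP : P ∈ admissible n 1) (hr : ((H₁ᴴ * H₁ - H₂ᴴ * H₂) * P).trace.re = r) :
    |(gapGrad H₁ H₂ (t • Q) * P).trace.re - r + t * curv H₁ H₂ Q P| ≤ 4 * a ^ 3 * t ^ 2 := by
  have h0 := (norm_nonneg _).trans ha₁
  obtain ⟨p, b, c⟩ := smul_mem_bound hQ h0 ht hta
  have h1 := norm_gapGrad_sub_gram_add_le p ha₁ ha₂ b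
  have h2 := abs_trace_re_mul_le (gapGrad H₁ H₂ (t • Q) - (H₁ᴴ * H₁ - H₂ᴴ * H₂)
    + (H₁ᴴ * H₁ * (t • Q) * (H₁ᴴ * H₁) - H₂ᴴ * H₂ * (t • Q) * (H₂ᴴ * H₂))) P
  have h3 : ((gapGrad H₁ H₂ (t • Q) - (H₁ᴴ * H₁ - H₂ᴴ * H₂)
    + (H₁ᴴ * H₁ * (t • Q) * (H₁ᴴ * H₁) - H₂ᴴ * H₂ * (t • Q) * (H₂ᴴ * H₂))) * P).trace.re
      = (gapGrad H₁ H₂ (t • Q) * P).trace.re - r + t * curv H₁ H₂ Q P := by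
    rw [← hr, curv, Matrix.add_mul, Matrix.sub_mul (gapGrad H₁ H₂ (t • Q)),
      Matrix.sub_mul _ _ P, Matrix.sub_mul (H₁ᴴ * H₁ * (t • Q) * (H₁ᴴ * H₁))]
    simp only [Matrix.trace_add, Matrix.trace_sub, Matrix.mul_smul, Matrix.smul_mul,
      Matrix.trace_smul, Complex.add_re, Complex.sub_re, Complex.smul_re, smul_eq_mul]
    ring
  rw [h3] at h2
  refine h2.trans ?_
  have hp := norm_le_one_of_mem hP
  calc _ ≤ (4 * a ^ 3 * t ^ 2) * 1 := by
        gcongr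
        exact h1.trans (by gcongr)
    _ = _ := mul_one _

/-- Directions that minimize `curv` to first order among the maximizers of the linear part
minimize it. -/
theorem curv_self_le_of_forall {r : ℝ} (hr : 0 ≤ r) {P Q : Matrix (Fin n) (Fin n) ℂ}
    (hQ : IsTraceMax (H₁ᴴ * H₁ - H₂ᴴ * H₂) Q) (hP : IsTraceMax (H₁ᴴ * H₁ - H₂ᴴ * H₂) P)
    (hQr : ((H₁ᴴ * H₁ - H₂ᴴ * H₂) * Q).trace.re = r)
    (h : curv H₁ H₂ Q Q ≤ curv H₁ H₂ Q P) : curv H₁ H₂ Q Q ≤ curv H₁ H₂ P P := by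
  have hΦ : (H₁ᴴ * H₁ - H₂ᴴ * H₂).IsHermitian :=
    (Matrix.isHermitian_conjTranspose_mul_self H₁).sub
      (Matrix.isHermitian_conjTranspose_mul_self H₂)
  have hPr : ((H₁ᴴ * H₁ - H₂ᴴ * H₂) * P).trace.re = r := by
    rw [← hQr]; exact le_antisymm (hQ.2 P hP.1) (hP.2 Q hQ.1)
  -- P − Q is an exact eigenmatrix, so curv(P − Q, P − Q) ≥ 0, whence curv(P, P) ≥ 2 curv(Q, P) −
  -- curv(Q, Q) ≥ curv(Q, Q).
  have h1 := le_curv_self H₁ H₂ (hP.1.1.isHermitian.sub hQ.1.1.isHermitian) hr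
  have h2 : (H₁ᴴ * H₁ - H₂ᴴ * H₂) * (P - Q) - r • (P - Q) = 0 := by
    rw [Matrix.mul_sub, hP.mul_eq hΦ, hQ.mul_eq hΦ, hPr, hQr, smul_sub, sub_self]
  rw [h2, norm_zero, mul_zero, sub_zero, zero_pow two_ne_zero, sub_zero, curv_sub_self] at h1
  have h3 : 0 ≤ r ^ 2 * ‖P - Q‖ ^ 2 := by positivity
  linarith

/-- If the largest eigenvalue is positive, then `gapSup` is differentiable near zero. -/
theorem exists_hasDerivWithinAt_gapSup {r : ℝ} (hr : 0 < r) {Q₀ : Matrix (Fin n) (Fin n) ℂ}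
    (h₀ : IsTraceMax (H₁ᴴ * H₁ - H₂ᴴ * H₂) Q₀)
    (hr₀ : ((H₁ᴴ * H₁ - H₂ᴴ * H₂) * Q₀).trace.re = r) {opt : ℝ → Matrix (Fin n) (Fin n) ℂ}
    (hopt : ∀ t, opt t ∈ admissible n 1)
    (hmax : ∀ t, 0 ≤ t → ∀ Q ∈ admissible n 1, gap H₁ H₂ (t • Q) ≤ gap H₁ H₂ (t • opt t)) :
    HasDerivWithinAt (gapSup H₁ H₂) r (Set.Ici 0) 0 ∧
    ∃ ε : ℝ, 0 < ε ∧ ∀ s ∈ Set.Ioo 0 ε, HasDerivWithinAt (gapSup H₁ H₂)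
      (gapGrad H₁ H₂ (s • opt s) * opt s).trace.re (Set.Ici 0) s := by
  obtain ⟨a, ha, ha₁, ha₂⟩ : ∃ a : ℝ, 1 ≤ a ∧ ‖H₁ᴴ * H₁‖ ≤ a ∧ ‖H₂ᴴ * H₂‖ ≤ a :=
    ⟨1 + ‖H₁ᴴ * H₁‖ + ‖H₂ᴴ * H₂‖, by linarith [norm_nonneg (H₁ᴴ * H₁), norm_nonneg (H₂ᴴ * H₂)], by linarith [norm_nonneg (H₂ᴴ * H₂)],
      by linarith [norm_nonneg (H₁ᴴ * H₁)]⟩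
  have h0 : 0 ≤ a := by linarith
  have hval : ∀ t, 0 ≤ t → gapSup H₁ H₂ t = gap H₁ H₂ (t • opt t) := fun t ht => by
    obtain ⟨Q, hQ, hQe⟩ := (isGreatest_gapSup (H₁ := H₁) (H₂ := H₂) ht).1
    exact le_antisymm (hQe ▸ hmax t ht Q hQ) (gap_le_gapSup ht (hopt t))
  have hsmall : ∀ {t : ℝ}, t < 1 / (2 * a) → t * a ≤ 1 / 2 := fun {t} ht => by
    rw [lt_div_iff₀ (by positivity)] at ht
    linarith
  refine ⟨hasDerivWithinAt_of_abs_sub_le (L := 8 * a ^ 2) ?_, ?_⟩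
  · filter_upwards [Ico_mem_nhdsGE (show (0 : ℝ) < 1 / (2 * a) by positivity)] with t ht
    have hta := hsmall ht.2
    -- The fixed direction Q₀ bounds the value from below with slope r; the direction `opt t` bounds
    -- it from above, since its slope at 0 is at most r.
    have e1 := abs_gap_smul_sub_le ha₁ ha₂ h₀.1 ht.1 le_rfl hta (by simp)
    have e2 := abs_gap_smul_sub_le ha₁ ha₂ (hopt t) ht.1 le_rfl hta (by simp)
    simp only [zero_smul] at e1 e2
    rw [gap_zero, sub_zero, gapGrad_zero, hr₀] at e1
    rw [gap_zero, sub_zero, gapGrad_zero] at e2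
    have e3 := mul_le_mul_of_nonneg_right (h₀.2 (opt t) (hopt t)) (sub_nonneg.2 ht.1)
    have e4 := hmax t ht.1 Q₀ h₀.1
    rw [gapSup_zero, sub_zero, hval t ht.1, abs_le]
    rw [hr₀] at e3
    constructor <;> linarith [(abs_le.1 e1).1, (abs_le.1 e2).2]
  · set M := 24 * a ^ 2 * (4 * a + r) + 8 * a ^ 3 with hM
    have hM0 : 0 < M := by positivity
    -- The first bound makes the gradient estimates available; the second gives M(s + t) ≤ r²/2,
    -- which the Lipschitz estimate requires.
    set ε := min (1 / (2 * a)) (r ^ 2 / (4 * M)) with hε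
    have hε1 : ∀ {t : ℝ}, t < ε → t * a ≤ 1 / 2 := fun ht => hsmall (ht.trans_le (min_le_left _ _))
    have hε2 : ∀ {t : ℝ}, t < ε → M * t ≤ r ^ 2 / 4 := fun {t} ht => by
      have := ht.trans_le (min_le_right _ _)
      rw [lt_div_iff₀ (by positivity)] at this
      linarith
    refine ⟨ε, by positivity, fun s hs => ?_⟩
    -- Envelope argument: `opt s` and `opt t` bound the value at t from both sides, and their slopes
    -- at s differ by O(|t − s|). The constant blows up as s → 0, which is harmless for
    -- differentiability at a fixed s.
    refine hasDerivWithinAt_of_abs_sub_le (L := 8 * a ^ 2 + 16 * a ^ 2 * (2 * M / r ^ 2 / s)) ?_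
    refine nhdsWithin_le_nhds ?_
    filter_upwards [Ioo_mem_nhds hs.1 hs.2] with t ht
    have hsa := hε1 hs.2
    have hta := hε1 ht.2
    have e1 := abs_gap_smul_sub_le ha₁ ha₂ (hopt s) ht.1.le hs.1.le hta hsa
    have e2 := abs_gap_smul_sub_le ha₁ ha₂ (hopt t) ht.1.le hs.1.le hta hsa
    have e3 := hmax t ht.1.le (opt s) (hopt s)
    have e4 := hmax s hs.1.le (opt t) (hopt t)
    have hs1 : s ≤ 1 := by nlinarith [hs.1]
    have e5 := mul_norm_sub_le_of_isTraceMax ha ha₁ ha₂ hr h₀ hr₀ hs.1 ht.1 hs1 hsa hta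
      (by rw [← hM, mul_add]; linarith [hε2 hs.2, hε2 ht.2])
      (isTraceMax_of_isMax H₁ H₂ hs.1 (hopt s) (hmax s hs.1.le))
      (isTraceMax_of_isMax H₁ H₂ ht.1 (hopt t) (hmax t ht.1.le))
    rw [← hM] at e5
    have e6 : ‖opt t - opt s‖ ≤ 2 * M / r ^ 2 / s * |t - s| := by
      rw [div_mul_eq_mul_div _ s, le_div_iff₀ hs.1, mul_comm _ s]
      exact e5
    obtain ⟨p, b, c⟩ := smul_mem_bound (hopt s) h0 hs.1.le hsa
    obtain ⟨p', b', c'⟩ := smul_mem_bound (hopt t) h0 hs.1.le hsa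
    have e7 : |(gapGrad H₁ H₂ (s • opt t) * opt t).trace.re
        - (gapGrad H₁ H₂ (s • opt s) * opt s).trace.re| ≤ 16 * a ^ 2 * ‖opt t - opt s‖ := by
      have f1 : (gapGrad H₁ H₂ (s • opt t) * opt t).trace.re
        - (gapGrad H₁ H₂ (s • opt s) * opt s).trace.re
        = ((gapGrad H₁ H₂ (s • opt t) - gapGrad H₁ H₂ (s • opt s)) * opt t).trace.re
          + (gapGrad H₁ H₂ (s • opt s) * (opt t - opt s)).trace.re := by
        simp only [Matrix.sub_mul, Matrix.mul_sub, Matrix.trace_sub, Complex.sub_re]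
        ring
      have f2 := norm_gapGrad_sub_le p' p ha₁ ha₂ b' b
      rw [← smul_sub, norm_smul, Real.norm_of_nonneg hs.1.le] at f2
      have f3 := norm_gapGrad_le p ha₁ ha₂ b
      have f4 := norm_le_one_of_mem (hopt t)
      rw [f1]
      refine (abs_add_le _ _).trans ((add_le_add (abs_trace_re_mul_le _ _)
        (abs_trace_re_mul_le _ _)).trans ?_)
      have hs0 := hs.1.le
      calc _ ≤ 8 * a ^ 2 * (s * ‖opt t - opt s‖) * 1 + 4 * a * ‖opt t - opt s‖ := by
            gcongr
        _ ≤ 8 * a ^ 2 * (1 * ‖opt t - opt s‖) * 1 + 4 * (a * a) * ‖opt t - opt s‖ := by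
            gcongr
            nlinarith
        _ ≤ _ := by
            have : 0 ≤ a ^ 2 * ‖opt t - opt s‖ := by positivity
            nlinarith
    have e8 : |((gapGrad H₁ H₂ (s • opt t) * opt t).trace.re
        - (gapGrad H₁ H₂ (s • opt s) * opt s).trace.re) * (t - s)|
        ≤ 16 * a ^ 2 * (2 * M / r ^ 2 / s) * (t - s) ^ 2 := by
      rw [abs_mul]
      calc _ ≤ 16 * a ^ 2 * (2 * M / r ^ 2 / s * |t - s|) * |t - s| := by
            gcongr
            exact e7.trans (by gcongr)
        _ = 16 * a ^ 2 * (2 * M / r ^ 2 / s) * (|t - s| * |t - s|) := by ring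
        _ = _ := by rw [abs_mul_abs_self, sq (t - s)]
    rw [hval t ht.1.le, hval s hs.1.le, abs_le]
    rw [sub_mul] at e8
    have hpos : 0 ≤ 16 * a ^ 2 * (2 * M / r ^ 2 / s) * (t - s) ^ 2 := (abs_nonneg _).trans e8
    rw [add_mul]
    constructor <;> linarith [(abs_le.1 e1).1, (abs_le.1 e2).2, (abs_le.1 e8).2]

theorem continuous_curv (H₁ : Matrix (Fin r₁) (Fin n) ℂ) (H₂ : Matrix (Fin r₂) (Fin n) ℂ) :
    Continuous fun p : Matrix (Fin n) (Fin n) ℂ × Matrix (Fin n) (Fin n) ℂ =>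
      curv H₁ H₂ p.1 p.2 := by
  unfold curv
  fun_prop

/-- Squeezing a quotient between two values of a continuous form at the points `opt t` and their
limit points, which maximize `l`. -/
theorem tendsto_neg_of_squeeze {X : Type*} [TopologicalSpace X] [FirstCountableTopology X]
    {C : Set X} (hC : IsCompact C) {b : X × X → ℝ} (hb : Continuous b) {l : X → ℝ}
    (hl : Continuous l) {opt : ℝ → X} (hopt : ∀ t, opt t ∈ C) {f : ℝ → ℝ} {L M m : ℝ}
    (hupper : ∀ᶠ t in 𝓝[>] (0 : ℝ), f t ≤ -b (opt t, opt t) + L * t)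
    (hlower : ∀ P ∈ C, (∀ P' ∈ C, l P' ≤ l P) →
      ∀ᶠ t in 𝓝[>] (0 : ℝ), -b (opt t, P) - L * t ≤ f t)
    (hmax : ∀ P ∈ C, ∀ᶠ t in 𝓝[>] (0 : ℝ), l P ≤ l (opt t) + M * t)
    (hmin : ∀ Q ∈ C, (∀ P ∈ C, l P ≤ l Q) →
      (∀ P ∈ C, (∀ P' ∈ C, l P' ≤ l P) → b (Q, Q) ≤ b (Q, P)) → b (Q, Q) = m) :
    Tendsto f (𝓝[>] 0) (𝓝 (-m)) := by
  rw [tendsto_iff_seq_tendsto]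
  intro x hx
  refine tendsto_of_subseq_tendsto fun ns hns => ?_
  obtain ⟨Q, hQ, φ, hφ, hlim⟩ := hC.tendsto_subseq fun k => hopt (x (ns k))
  refine ⟨φ, ?_⟩
  obtain ⟨z, hz⟩ : ∃ z : ℕ → ℝ, z = fun k => x (ns (φ k)) := ⟨_, rfl⟩
  have hz' : Tendsto z atTop (𝓝[>] 0) := hz ▸ (hx.comp hns).comp hφ.tendsto_atTop
  have hz0 : Tendsto z atTop (𝓝 0) := hz'.mono_right nhdsWithin_le_nhds
  have hlim' : Tendsto (fun k => opt (z k)) atTop (𝓝 Q) := hz ▸ hlim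
  have hup : Tendsto (fun k => -b (opt (z k), opt (z k)) + L * z k) atTop (𝓝 (-b (Q, Q))) := by
    simpa using ((hb.tendsto (Q, Q)).comp (hlim'.prodMk_nhds hlim')).neg.add (hz0.const_mul L)
  have hlo : ∀ P, Tendsto (fun k => -b (opt (z k), P) - L * z k) atTop (𝓝 (-b (Q, P))) := fun P => by
    simpa using ((hb.tendsto (Q, P)).comp (hlim'.prodMk_nhds tendsto_const_nhds)).neg.sub
      (hz0.const_mul L)
  have hQmax : ∀ P ∈ C, l P ≤ l Q := fun P hP => by
    have h1 : Tendsto (fun k => l (opt (z k)) + M * z k) atTop (𝓝 (l Q)) := by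
      simpa using ((hl.tendsto Q).comp hlim').add (hz0.const_mul M)
    exact ge_of_tendsto h1 (hz'.eventually (hmax P hP))
  have hmQ : b (Q, Q) = m := hmin Q hQ hQmax fun P hP hPmax => by
    refine neg_le_neg_iff.1 (le_of_tendsto_of_tendsto (hlo P) hup ?_)
    filter_upwards [hz'.eventually hupper, hz'.eventually (hlower P hP hPmax)] with k h1 h2
    exact h2.trans h1
  -- The limit point Q is itself an admissible P, and with it both bounds tend to −b(Q, Q).
  have hgoal := tendsto_of_tendsto_of_tendsto_of_le_of_le' (hlo Q) hup
    (hz'.eventually (hlower Q hQ hQmax)) (hz'.eventually hupper)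
  rw [hmQ, hz] at hgoal
  exact hgoal

/-- The slope at zero of the optimal multiplier is minus the least curvature. -/
theorem tendsto_slope_trace_gapGrad {r m : ℝ} (hr : 0 < r)
    (hm : IsLeast ((fun Q => curv H₁ H₂ Q Q) '' {Q | IsTraceMax (H₁ᴴ * H₁ - H₂ᴴ * H₂) Q}) m)
    (hr₀ : ∀ Q, IsTraceMax (H₁ᴴ * H₁ - H₂ᴴ * H₂) Q →
      ((H₁ᴴ * H₁ - H₂ᴴ * H₂) * Q).trace.re = r) {opt : ℝ → Matrix (Fin n) (Fin n) ℂ}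
    (hopt : ∀ t, opt t ∈ admissible n 1)
    (hmax : ∀ t, 0 ≤ t → ∀ Q ∈ admissible n 1, gap H₁ H₂ (t • Q) ≤ gap H₁ H₂ (t • opt t)) :
    Tendsto (fun t => ((gapGrad H₁ H₂ (t • opt t) * opt t).trace.re - r) / t) (𝓝[>] 0)
      (𝓝 (-m)) := by
  obtain ⟨a, ha, ha₁, ha₂⟩ : ∃ a : ℝ, 1 ≤ a ∧ ‖H₁ᴴ * H₁‖ ≤ a ∧ ‖H₂ᴴ * H₂‖ ≤ a :=
    ⟨1 + ‖H₁ᴴ * H₁‖ + ‖H₂ᴴ * H₂‖, by linarith [norm_nonneg (H₁ᴴ * H₁), norm_nonneg (H₂ᴴ * H₂)],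
      by linarith [norm_nonneg (H₂ᴴ * H₂)], by linarith [norm_nonneg (H₁ᴴ * H₁)]⟩
  have h0 : 0 ≤ a := by linarith
  obtain ⟨Q₀, h₀, -⟩ := hm.1
  have hsmall : ∀ᶠ t in 𝓝[>] (0 : ℝ), 0 < t ∧ t * a ≤ 1 / 2 := by
    filter_upwards [Ioo_mem_nhdsGT (show (0 : ℝ) < 1 / (2 * a) by positivity)] with t ht
    refine ⟨ht.1, ?_⟩
    have := ht.2
    rw [lt_div_iff₀ (by positivity)] at this
    linarith
  have : FirstCountableTopology (Matrix (Fin n) (Fin n) ℂ) :=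
    inferInstanceAs (FirstCountableTopology (Fin n → Fin n → ℂ))
  refine tendsto_neg_of_squeeze (isCompact_admissible 1) (continuous_curv H₁ H₂)
    (l := fun X => ((H₁ᴴ * H₁ - H₂ᴴ * H₂) * X).trace.re) (by fun_prop) hopt
    (L := 4 * a ^ 3) (M := 8 * a ^ 2) ?_ ?_ ?_ ?_
  · filter_upwards [hsmall] with t ht
    have e1 := abs_trace_gapGrad_sub_add_le ha₁ ha₂ ht.1.le ht.2 (hopt t) (hopt t) rfl
    have e2 := h₀.2 (opt t) (hopt t)
    rw [hr₀ Q₀ h₀] at e2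
    rw [div_le_iff₀ ht.1]
    linarith [(abs_le.1 e1).2]
  · intro P hP hPmax
    filter_upwards [hsmall] with t ht
    have e1 := abs_trace_gapGrad_sub_add_le ha₁ ha₂ ht.1.le ht.2 (hopt t) hP (hr₀ P ⟨hP, hPmax⟩)
    have e2 := (isTraceMax_of_isMax H₁ H₂ ht.1 (hopt t) (hmax t ht.1.le)).2 P hP
    rw [le_div_iff₀ ht.1]
    linarith [(abs_le.1 e1).1]
  · intro P hP
    filter_upwards [hsmall] with t ht
    obtain ⟨p, b, c⟩ := smul_mem_bound (hopt t) h0 ht.1.le ht.2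
    have e1 := (isTraceMax_of_isMax H₁ H₂ ht.1 (hopt t) (hmax t ht.1.le)).2 P hP
    have e2 := (norm_gapGrad_sub_gram_le p ha₁ ha₂ b).trans
      (mul_le_mul_of_nonneg_left c (by positivity))
    have e3 : ∀ X ∈ admissible n 1, |(gapGrad H₁ H₂ (t • opt t) * X).trace.re
        - ((H₁ᴴ * H₁ - H₂ᴴ * H₂) * X).trace.re| ≤ 4 * a ^ 2 * t := fun X hX => by
      have f1 := abs_trace_re_mul_le (gapGrad H₁ H₂ (t • opt t) - (H₁ᴴ * H₁ - H₂ᴴ * H₂)) X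
      rw [Matrix.sub_mul (gapGrad H₁ H₂ (t • opt t)), Matrix.trace_sub, Complex.sub_re] at f1
      exact f1.trans ((mul_le_of_le_one_right (norm_nonneg _) (norm_le_one_of_mem hX)).trans e2)
    linarith [(abs_le.1 (e3 P hP)).1, (abs_le.1 (e3 _ (hopt t))).2]
  · intro Q hQ hQmax hle
    have hleast : IsLeast ((fun Q => curv H₁ H₂ Q Q) ''
        {Q | IsTraceMax (H₁ᴴ * H₁ - H₂ᴴ * H₂) Q}) (curv H₁ H₂ Q Q) := by
      refine ⟨⟨Q, ⟨hQ, hQmax⟩, rfl⟩, ?_⟩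
      rintro _ ⟨P, hP, rfl⟩
      exact curv_self_le_of_forall hr.le ⟨hQ, hQmax⟩ hP (hr₀ Q ⟨hQ, hQmax⟩)
        (hle P hP.1 hP.2)
    exact hleast.unique hm

/-- For K = C†C, the identity det(1 + XY) = det(1 + YX) moves the Gram matrix inside: log det(1 + C
H†H C†). This is monotone along the segment from H₁†H₁ to H₂†H₂, its derivative being the trace of a
product of positive semidefinite matrices. -/
theorem gapSup_eq_zero (h : (H₂ᴴ * H₂ - H₁ᴴ * H₁).PosSemidef) {t : ℝ} (ht : 0 ≤ t) :
    gapSup H₁ H₂ t = 0 := by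
  have hle : ∀ K : Matrix (Fin n) (Fin n) ℂ, K.PosSemidef → gap H₁ H₂ K ≤ 0 := by
    intro K hK
    obtain ⟨C, rfl⟩ := exists_eq_conjTranspose_mul_self hK
    have hdet : ∀ {p : ℕ} (H : Matrix (Fin p) (Fin n) ℂ),
        logDet H (Cᴴ * C) = Real.log (1 + C * (Hᴴ * H) * Cᴴ).det.re := fun H => by
      rw [logDet, ← Matrix.mul_assoc, Matrix.mul_assoc, Matrix.det_one_add_mul_comm]
      simp only [Matrix.mul_assoc]
    rw [gap, hdet, hdet, sub_nonpos]
    have hPD : ∀ x ∈ Set.Icc (0 : ℝ) 1, (1 + C * (H₁ᴴ * H₁) * Cᴴ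
        + x • (C * (H₂ᴴ * H₂ - H₁ᴴ * H₁) * Cᴴ)).PosDef := fun x hx =>
      (posDef_one_add_mul_mul C (Matrix.posSemidef_conjTranspose_mul_self H₁)).add_posSemidef
        ((h.mul_mul_conjTranspose_same C).smul hx.1)
    have hder := fun x hx => hasDerivAt_log_det (hPD x hx)
    have hmono : MonotoneOn (fun x : ℝ => Real.log (1 + C * (H₁ᴴ * H₁) * Cᴴ
        + x • (C * (H₂ᴴ * H₂ - H₁ᴴ * H₁) * Cᴴ)).det.re) (Set.Icc 0 1) := by
      refine monotoneOn_of_deriv_nonneg (convex_Icc 0 1)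
        (fun x hx => (hder x hx).continuousAt.continuousWithinAt)
        (fun x hx => (hder x (interior_subset hx)).differentiableAt.differentiableWithinAt)
        fun x hx => ?_
      rw [(hder x (interior_subset hx)).deriv]
      exact trace_mul_nonneg (hPD x (interior_subset hx)).inv.posSemidef
        (h.mul_mul_conjTranspose_same C)
    have := hmono (Set.left_mem_Icc.2 zero_le_one) (Set.right_mem_Icc.2 zero_le_one) zero_le_one
    simp only [zero_smul, add_zero, one_smul] at this
    rwa [add_assoc, ← Matrix.add_mul, ← Matrix.mul_add, add_sub_cancel] at this
  refine le_antisymm ?_ ?_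
  · obtain ⟨Q, hQ, hQe⟩ := (isGreatest_gapSup (H₁ := H₁) (H₂ := H₂) ht).1
    exact hQe ▸ hle _ (hQ.1.smul ht)
  · simpa [gap_zero] using
      gap_le_gapSup (H₁ := H₁) (H₂ := H₂) ht (zero_mem_admissible zero_le_one)

end Value

/-- A symmetric form is diagonal in some orthonormal basis of a given subspace. -/
theorem exists_orthonormalBasis_diagonalizing {F : Type*} [NormedAddCommGroup F]
    [InnerProductSpace ℂ F] [FiniteDimensional ℂ F] (E : Submodule ℂ F) {S : F →ₗ[ℂ] F}
    (hS : S.IsSymmetric) :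
    ∃ u : OrthonormalBasis (Fin (Module.finrank ℂ E)) ℂ E,
      ∀ i j, i ≠ j → inner ℂ (u j : F) (S (u i)) = 0 := by
  obtain ⟨T, hin⟩ : ∃ T : E →ₗ[ℂ] E, ∀ x y : E, inner ℂ x (T y) = inner ℂ (x : F) (S y) :=
    ⟨E.orthogonalProjectionOnto.toLinearMap ∘ₗ S ∘ₗ E.subtype, fun x y =>
      Submodule.inner_orthogonalProjectionOnto_eq_of_mem_left x _⟩
  have hT : T.IsSymmetric := fun x y => by
    rw [hin, ← inner_conj_symm, hin, inner_conj_symm]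
    exact hS x y
  refine ⟨hT.eigenvectorBasis rfl, fun i j hij => ?_⟩
  have h1 := hin (hT.eigenvectorBasis rfl j) (hT.eigenvectorBasis rfl i)
  rw [hT.apply_eigenvectorBasis, inner_smul_right,
    (hT.eigenvectorBasis rfl).orthonormal.2 hij.symm, mul_zero] at h1
  exact h1.symm

/-! ### The top eigenspace and its orthonormal bases -/

section Eigenspace

variable {nT nR nE : ℕ} {Hm : Matrix (Fin nR) (Fin nT) ℂ} {He : Matrix (Fin nE) (Fin nT) ℂ}
  {Nm Ne : ℝ}

theorem posSemidef_lambdaMax_sub_Phi :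
    (lambdaMax Hm He Nm Ne • (1 : Matrix (Fin nT) (Fin nT) ℂ) - Phi Hm He Nm Ne).PosSemidef := by
  have hΦ := isHermitian_Phi Hm He Nm Ne
  refine Matrix.posSemidef_iff_isHermitian_and_spectrum_nonneg.2 ⟨?_, ?_⟩
  · refine Matrix.IsHermitian.sub ?_ hΦ
    simp [Matrix.IsHermitian, Matrix.conjTranspose_smul]
  · have h1 : lambdaMax Hm He Nm Ne • (1 : Matrix (Fin nT) (Fin nT) ℂ)
        = algebraMap ℂ _ (lambdaMax Hm He Nm Ne : ℂ) := by
      rw [Algebra.algebraMap_eq_smul_one]; simp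
    rw [h1, ← spectrum.singleton_sub_eq, hΦ.spectrum_eq_image_range]
    rintro _ ⟨_, rfl, _, ⟨_, ⟨i, rfl⟩, rfl⟩, rfl⟩
    simp only [Set.mem_ofPred_eq, Complex.coe_algebraMap, ← Complex.ofReal_sub]
    exact_mod_cast sub_nonneg.2 (le_ciSup (Set.finite_range _).bddAbove i)

theorem multiplicity_pos (hT : 0 < nT) : 0 < multiplicity Hm He Nm Ne := by
  have : Nonempty (Fin nT) := ⟨⟨0, hT⟩⟩
  obtain ⟨i, hi⟩ := exists_eq_ciSup_of_finite (f := (isHermitian_Phi Hm He Nm Ne).eigenvalues)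
  refine Module.finrank_pos_iff_exists_ne_zero.2
    ⟨⟨(isHermitian_Phi Hm He Nm Ne).eigenvectorBasis i, ?_⟩, ?_⟩
  · rw [Module.End.mem_eigenspace_iff]
    have h := (isHermitian_Phi Hm He Nm Ne).mulVec_eigenvectorBasis i
    rw [hi] at h
    ext k
    simpa [Matrix.toLpLin_apply, lambdaMax] using congrFun h k
  · intro h
    have h1 := congrArg (fun x : topEigenspace Hm He Nm Ne => ‖(x : EuclideanSpace ℂ (Fin nT))‖) h
    simp at h1

/-- The matrix with columns `u_1, …, u_l`. -/
def TopBasis.mat (u : TopBasis Hm He Nm Ne) :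
    Matrix (Fin nT) (Fin (multiplicity Hm He Nm Ne)) ℂ :=
  Matrix.of fun k i => u.vec i k

variable (u : TopBasis Hm He Nm Ne)

theorem TopBasis.conjTranspose_mul_mul_mat_apply (X : Matrix (Fin nT) (Fin nT) ℂ)
    (i j : Fin (multiplicity Hm He Nm Ne)) :
    (u.matᴴ * X * u.mat) j i = star (u.vec j) ⬝ᵥ X *ᵥ u.vec i := by
  rw [Matrix.mul_assoc, Matrix.mul_apply']
  rfl

theorem TopBasis.star_vec_dotProduct (i j : Fin (multiplicity Hm He Nm Ne)) :
    star (u.vec j) ⬝ᵥ u.vec i = if j = i then 1 else 0 := by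
  have h := orthonormal_iff_ite.1 u.orthonormal j i
  rw [← h, Submodule.coe_inner, EuclideanSpace.inner_eq_star_dotProduct, dotProduct_comm]
  rfl

theorem TopBasis.conjTranspose_mat_mul_mat : u.matᴴ * u.mat = 1 := by
  ext j i
  have h := u.conjTranspose_mul_mul_mat_apply 1 i j
  rw [Matrix.mul_one, Matrix.one_mulVec, u.star_vec_dotProduct] at h
  rw [h, Matrix.one_apply]

theorem TopBasis.Phi_mulVec_vec (i : Fin (multiplicity Hm He Nm Ne)) :
    Phi Hm He Nm Ne *ᵥ u.vec i = lambdaMax Hm He Nm Ne • u.vec i := by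
  have h := Module.End.mem_eigenspace_iff.1 (u i).2
  have h1 := congrArg WithLp.ofLp h
  ext k
  simpa [Matrix.toLpLin_apply, TopBasis.vec] using congrFun h1 k

theorem TopBasis.Phi_mul_mat : Phi Hm He Nm Ne * u.mat = lambdaMax Hm He Nm Ne • u.mat := by
  ext k i
  exact congrFun (u.Phi_mulVec_vec i) k

/-- UU† is the orthogonal projection onto E, and the hypothesis puts the columns of Q in E. -/
theorem TopBasis.mat_mul_conjTranspose_mul {Q : Matrix (Fin nT) (Fin nT) ℂ}
    (h : Phi Hm He Nm Ne * Q = lambdaMax Hm He Nm Ne • Q) : u.mat * (u.matᴴ * Q) = Q := by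
  ext k c
  have hmem : WithLp.toLp 2 (Q.col c) ∈ topEigenspace Hm He Nm Ne := by
    rw [Module.End.mem_eigenspace_iff]
    ext r
    have h0 : (Phi Hm He Nm Ne *ᵥ Q.col c) r = (Phi Hm He Nm Ne * Q) r c := rfl
    rw [h] at h0
    simpa [Matrix.toLpLin_apply] using h0
  have h1 := u.sum_repr' ⟨_, hmem⟩
  have h2 := congrArg (fun x : topEigenspace Hm He Nm Ne => (x : EuclideanSpace ℂ (Fin nT)) k) h1
  simp only [Submodule.coe_inner, EuclideanSpace.inner_eq_star_dotProduct] at h2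
  simp only [AddSubmonoidClass.coe_finsetSum, WithLp.ofLp_sum, Finset.sum_apply] at h2
  rw [Matrix.mul_apply]
  refine Eq.trans (Finset.sum_congr rfl fun i _ => ?_) h2
  rw [mul_comm, Matrix.mul_apply', dotProduct_comm]
  rfl

theorem TopBasis.eigenCov_eq (α : Fin (multiplicity Hm He Nm Ne) → ℝ) :
    eigenCov u α = u.mat * Matrix.diagonal (fun i => (α i : ℂ)) * u.matᴴ := by
  ext r c
  rw [eigenCov, Matrix.sum_apply, Matrix.mul_apply]
  refine Finset.sum_congr rfl fun i _ => ?_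
  rw [Matrix.mul_diagonal, Matrix.smul_apply, Matrix.vecMulVec_apply, Matrix.conjTranspose_apply,
    TopBasis.mat, Matrix.of_apply, Matrix.of_apply, Complex.real_smul, Pi.star_apply]
  ring

/-- Every Hermitian form is diagonal in some orthonormal basis of the eigenspace. -/
theorem exists_topBasis_diagonalizing {S : Matrix (Fin nT) (Fin nT) ℂ} (hS : S.IsHermitian) :
    ∃ u : TopBasis Hm He Nm Ne, ∀ i j, i ≠ j → star (u.vec j) ⬝ᵥ S *ᵥ u.vec i = 0 := by
  obtain ⟨u, hu⟩ := exists_orthonormalBasis_diagonalizing (topEigenspace Hm He Nm Ne)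
    (Matrix.isSymmetric_toEuclideanLin_iff.2 hS)
  refine ⟨u, fun i j hij => ?_⟩
  have h1 := hu i j hij
  rw [EuclideanSpace.inner_eq_star_dotProduct, dotProduct_comm] at h1
  exact h1

theorem trace_mul_diagonal_mul_diagonal {l : ℕ} {X : Matrix (Fin l) (Fin l) ℂ}
    (hX : X.IsHermitian) (d : Fin l → ℝ) :
    (X * Matrix.diagonal (fun i => (d i : ℂ)) * X * Matrix.diagonal (fun i => (d i : ℂ))).trace.re
      = ∑ i, ∑ j, d i * d j * ‖X j i‖ ^ 2 := by
  rw [Matrix.trace, Complex.re_sum]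
  refine Finset.sum_congr rfl fun i _ => ?_
  rw [Matrix.diag_apply, Matrix.mul_diagonal, Matrix.mul_apply, Finset.sum_mul, Complex.re_sum]
  refine Finset.sum_congr rfl fun j _ => ?_
  rw [Matrix.mul_diagonal, ← hX.apply i j, ← Complex.normSq_eq_norm_sq, Complex.normSq_apply]
  simp
  ring

end Eigenspace

/-! ### Reduction to the normalized problem; maximizers and weights -/

section Reduction

variable {nT nR nE : ℕ} {Hm : Matrix (Fin nR) (Fin nT) ℂ} {He : Matrix (Fin nE) (Fin nT) ℂ}
  {Nm Ne : ℝ}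

theorem conjTranspose_sqrt_smul_mul {r : ℝ} (hr : 0 ≤ r) :
    (√r • He)ᴴ * (√r • He) = r • (Heᴴ * He) := by
  rw [Matrix.conjTranspose_smul, Matrix.smul_mul, Matrix.mul_smul, smul_smul, star_trivial,
    Real.mul_self_sqrt hr]

theorem Phi_eq (h : 0 ≤ Nm / Ne) :
    Phi Hm He Nm Ne = Hmᴴ * Hm - (√(Nm / Ne) • He)ᴴ * (√(Nm / Ne) • He) := by
  rw [Phi, conjTranspose_sqrt_smul_mul h]

/-- Scaling the eavesdropper's channel by √(Nm/Ne) gives both channels noise level Nm, and P/Nm = nR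
· s. -/
theorem secrecyRate_power_smul (hNm : 0 < Nm) (hNe : 0 < Ne) (s : ℝ)
    (Q : Matrix (Fin nT) (Fin nT) ℂ) :
    secrecyRate Hm He Nm Ne (power nR Nm s • Q)
      = 1 / (nR : ℝ) * gap Hm (√(Nm / Ne) • He) ((nR * s : ℝ) • Q) := by
  have h1 : (1 / Nm) • (Hm * (power nR Nm s • Q) * Hmᴴ) = Hm * ((nR * s : ℝ) • Q) * Hmᴴ := by
    simp only [Matrix.mul_smul, Matrix.smul_mul, smul_smul, power]
    congr 1
    field_simp
  have h2 : (1 / Ne) • (He * (power nR Nm s • Q) * Heᴴ)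
      = (√(Nm / Ne) • He) * ((nR * s : ℝ) • Q) * (√(Nm / Ne) • He)ᴴ := by
    simp only [Matrix.conjTranspose_smul, Matrix.mul_smul, Matrix.smul_mul, smul_smul, power,
      star_trivial]
    rw [show √(Nm / Ne) * (nR * s * √(Nm / Ne)) = nR * s * (√(Nm / Ne) * √(Nm / Ne)) by ring,
      Real.mul_self_sqrt (by positivity)]
    congr 1
    field_simp
  rw [secrecyRate, gap, logDet, logDet, h1, h2]

theorem smul_mem_admissible {n : ℕ} {P : ℝ} (hP : 0 ≤ P) {Q : Matrix (Fin n) (Fin n) ℂ}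
    (hQ : Q ∈ admissible n 1) : P • Q ∈ admissible n P :=
  ⟨hQ.1.smul hP, by
    rw [Matrix.trace_smul, Complex.smul_re, smul_eq_mul]
    exact mul_le_of_le_one_right hP hQ.2⟩

theorem admissible_eq_image {n : ℕ} {P : ℝ} (hP : 0 ≤ P) :
    admissible n P = (fun Q => P • Q) '' admissible n 1 := by
  refine Set.Subset.antisymm (fun K hK => ?_) ?_
  · rcases hP.eq_or_lt with h | h
    · have h1 : K = 0 := by
        open scoped Matrix.Norms.Frobenius in
        exact norm_le_zero_iff.1 ((norm_le_trace hK.1).trans (hK.2.trans h.ge))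
      exact ⟨0, zero_mem_admissible zero_le_one, by simp [h1]⟩
    · refine ⟨P⁻¹ • K, ⟨hK.1.smul (inv_nonneg.2 hP), ?_⟩, smul_inv_smul₀ h.ne' K⟩
      rw [Matrix.trace_smul, Complex.smul_re, smul_eq_mul, inv_mul_le_iff₀ h, mul_one]
      exact hK.2
  · rintro _ ⟨Q, hQ, rfl⟩
    exact smul_mem_admissible hP hQ

theorem isGreatest_secrecyRate (hNm : 0 < Nm) (hNe : 0 < Ne) {s : ℝ} (hs : 0 ≤ s) :
    IsGreatest (secrecyRate Hm He Nm Ne '' admissible nT (power nR Nm s))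
      (1 / (nR : ℝ) * gapSup Hm (√(Nm / Ne) • He) (nR * s)) := by
  have hP : 0 ≤ power nR Nm s := by unfold power; positivity
  have h := isGreatest_gapSup (H₁ := Hm) (H₂ := √(Nm / Ne) • He) (t := nR * s) (by positivity)
  rw [admissible_eq_image hP, Set.image_image]
  simp only [secrecyRate_power_smul hNm hNe]
  refine ⟨?_, ?_⟩
  · obtain ⟨Q, hQ, hQe⟩ := h.1
    exact ⟨Q, hQ, congrArg _ hQe⟩
  · rintro _ ⟨Q, hQ, rfl⟩
    exact mul_le_mul_of_nonneg_left (h.2 ⟨Q, hQ, rfl⟩) (by positivity)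

theorem secrecyCapacity_eq (hNm : 0 < Nm) (hNe : 0 < Ne) {s : ℝ} (hs : 0 ≤ s) :
    secrecyCapacity Hm He Nm Ne s = 1 / (nR : ℝ) * gapSup Hm (√(Nm / Ne) • He) (nR * s) :=
  (isGreatest_secrecyRate hNm hNe hs).csSup_eq

variable (u : TopBasis Hm He Nm Ne)

theorem eigenCov_mem_admissible {α : Fin (multiplicity Hm He Nm Ne) → ℝ}
    (hα : α ∈ stdSimplex ℝ (Fin (multiplicity Hm He Nm Ne))) :
    eigenCov u α ∈ admissible nT 1 := by
  refine ⟨Matrix.posSemidef_sum _ fun i _ =>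
    (Matrix.posSemidef_vecMulVec_self_star (u.vec i)).smul (hα.1 i), ?_⟩
  rw [eigenCov, Matrix.trace_sum, Complex.re_sum, ← hα.2]
  refine (Finset.sum_congr rfl fun i _ => ?_).le
  rw [Matrix.trace_smul, Matrix.trace_vecMulVec, dotProduct_comm, u.star_vec_dotProduct]
  simp

theorem trace_Phi_mul_eigenCov {α : Fin (multiplicity Hm He Nm Ne) → ℝ}
    (hα : α ∈ stdSimplex ℝ (Fin (multiplicity Hm He Nm Ne))) :
    (Phi Hm He Nm Ne * eigenCov u α).trace.re = lambdaMax Hm He Nm Ne := by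
  have h : (Phi Hm He Nm Ne * eigenCov u α).trace.re = ∑ i, α i * lambdaMax Hm He Nm Ne := by
    rw [eigenCov, Matrix.mul_sum, Matrix.trace_sum, Complex.re_sum]
    refine Finset.sum_congr rfl fun i _ => ?_
    rw [Matrix.mul_smul, Matrix.trace_smul, trace_mul_vecMulVec, u.Phi_mulVec_vec, dotProduct_smul,
      u.star_vec_dotProduct]
    simp
  rw [h, ← Finset.sum_mul, hα.2, one_mul]

theorem trace_Phi_mul_le (hr : 0 ≤ lambdaMax Hm He Nm Ne) {Q : Matrix (Fin nT) (Fin nT) ℂ}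
    (hQ : Q ∈ admissible nT 1) : (Phi Hm He Nm Ne * Q).trace.re ≤ lambdaMax Hm He Nm Ne := by
  have h := trace_mul_nonneg (posSemidef_lambdaMax_sub_Phi (Hm := Hm) (He := He) (Nm := Nm)
    (Ne := Ne)) hQ.1
  rw [Matrix.sub_mul, Matrix.smul_mul, Matrix.one_mul, Matrix.trace_sub, Matrix.trace_smul,
    Complex.sub_re, Complex.smul_re, smul_eq_mul] at h
  nlinarith [mul_le_mul_of_nonneg_left hQ.2 hr]

theorem isTraceMax_eigenCov (hr : 0 ≤ lambdaMax Hm He Nm Ne)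
    {α : Fin (multiplicity Hm He Nm Ne) → ℝ}
    (hα : α ∈ stdSimplex ℝ (Fin (multiplicity Hm He Nm Ne))) :
    IsTraceMax (Phi Hm He Nm Ne) (eigenCov u α) :=
  ⟨eigenCov_mem_admissible u hα, fun _ hQ =>
    (trace_Phi_mul_le hr hQ).trans_eq (trace_Phi_mul_eigenCov u hα).symm⟩

theorem exists_mem_stdSimplex (hT : 0 < nT) :
    ∃ α, α ∈ stdSimplex ℝ (Fin (multiplicity Hm He Nm Ne)) :=
  ⟨_, single_mem_stdSimplex ℝ ⟨0, multiplicity_pos hT⟩⟩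

theorem IsTraceMax.trace_Phi_eq (hT : 0 < nT) (hr : 0 ≤ lambdaMax Hm He Nm Ne)
    {Q : Matrix (Fin nT) (Fin nT) ℂ} (hQ : IsTraceMax (Phi Hm He Nm Ne) Q) :
    (Phi Hm He Nm Ne * Q).trace.re = lambdaMax Hm He Nm Ne := by
  obtain ⟨α, hα⟩ := exists_mem_stdSimplex (Hm := Hm) (He := He) (Nm := Nm) (Ne := Ne) hT
  obtain ⟨u, -⟩ := exists_topBasis_diagonalizing (Hm := Hm) (He := He) (Nm := Nm) (Ne := Ne)
    (isHermitian_Phi Hm He Nm Ne)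
  refine le_antisymm (trace_Phi_mul_le hr hQ.1) ?_
  rw [← trace_Phi_mul_eigenCov u hα]
  exact hQ.2 _ (eigenCov_mem_admissible u hα)

/-- The weights `u_i† Q u_i` of a covariance matrix in the basis `u`. -/
def TopBasis.weight (Q : Matrix (Fin nT) (Fin nT) ℂ) (i : Fin (multiplicity Hm He Nm Ne)) : ℝ :=
  (star (u.vec i) ⬝ᵥ Q *ᵥ u.vec i).re

theorem IsTraceMax.mat_mul_mul_mat (hT : 0 < nT) (hr : 0 ≤ lambdaMax Hm He Nm Ne)
    {Q : Matrix (Fin nT) (Fin nT) ℂ} (hQ : IsTraceMax (Phi Hm He Nm Ne) Q) :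
    u.mat * (u.matᴴ * Q * u.mat) * u.matᴴ = Q := by
  have h1 := hQ.mul_eq (isHermitian_Phi Hm He Nm Ne)
  rw [hQ.trace_Phi_eq hT hr] at h1
  have h2 := u.mat_mul_conjTranspose_mul h1
  have h3 : Q * u.mat * u.matᴴ = Q := by
    have h4 := congrArg Matrix.conjTranspose h2
    rwa [Matrix.conjTranspose_mul, Matrix.conjTranspose_mul, Matrix.conjTranspose_conjTranspose,
      hQ.1.1.isHermitian.eq] at h4
  calc _ = u.mat * (u.matᴴ * (Q * u.mat * u.matᴴ)) := by simp only [Matrix.mul_assoc]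
    _ = Q := by rw [h3, h2]

/-- The weights sum to tr Q because Q is supported in E, and λ tr Q = tr ΦQ = λ forces tr Q = 1.
This is where λ > 0 rather than λ ≥ 0 matters. -/
theorem IsTraceMax.weight_mem (hT : 0 < nT) (hr : 0 < lambdaMax Hm He Nm Ne)
    {Q : Matrix (Fin nT) (Fin nT) ℂ} (hQ : IsTraceMax (Phi Hm He Nm Ne) Q) :
    u.weight Q ∈ stdSimplex ℝ (Fin (multiplicity Hm He Nm Ne)) := by
  have h1 := hQ.mul_eq (isHermitian_Phi Hm He Nm Ne)
  have h2 := hQ.trace_Phi_eq hT hr.le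
  refine ⟨fun i => hQ.1.1.re_dotProduct_nonneg (u.vec i), ?_⟩
  have h3 : Q.trace.re = 1 := by
    have h4 := congrArg (fun X => (Matrix.trace X).re) h1
    simp only [h2, Matrix.trace_smul, Complex.smul_re, smul_eq_mul] at h4
    exact (mul_eq_left₀ hr.ne').1 h4.symm
  rw [← h3]
  conv_rhs => rw [← hQ.mat_mul_mul_mat u hT hr.le, Matrix.trace_mul_comm, ← Matrix.mul_assoc,
    u.conjTranspose_mat_mul_mat, Matrix.one_mul, Matrix.trace, Complex.re_sum]
  exact Finset.sum_congr rfl fun i _ => by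
    rw [Matrix.diag_apply, u.conjTranspose_mul_mul_mat_apply]; rfl

/-- The basis is chosen to diagonalize the compression of Q itself to E, which determines Q since Q
is supported in E. -/
theorem IsTraceMax.exists_eq_eigenCov (hT : 0 < nT) (hr : 0 < lambdaMax Hm He Nm Ne)
    {Q : Matrix (Fin nT) (Fin nT) ℂ} (hQ : IsTraceMax (Phi Hm He Nm Ne) Q) :
    ∃ u : TopBasis Hm He Nm Ne, ∃ α ∈ stdSimplex ℝ (Fin (multiplicity Hm He Nm Ne)),
      Q = eigenCov u α := by
  obtain ⟨u, hu⟩ := exists_topBasis_diagonalizing (Hm := Hm) (He := He) (Nm := Nm) (Ne := Ne)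
    hQ.1.1.isHermitian
  refine ⟨u, u.weight Q, hQ.weight_mem u hT hr, ?_⟩
  rw [u.eigenCov_eq, ← hQ.mat_mul_mul_mat u hT hr.le]
  congr 2
  ext j i
  rw [hQ.mat_mul_mul_mat u hT hr.le, u.conjTranspose_mul_mul_mat_apply, Matrix.diagonal_apply]
  split_ifs with h
  · subst h
    apply Complex.ext
    · rfl
    · exact hQ.1.1.isHermitian.im_star_dotProduct_mulVec_self _
  · exact hu i j (_root_.Ne.symm h)

theorem trace_compression {l : Type*} [Fintype l] (A : Matrix (Fin nT) (Fin nT) ℂ)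
    (U : Matrix (Fin nT) l ℂ) (S : Matrix l l ℂ) :
    (A * (U * S * Uᴴ) * A * (U * S * Uᴴ)).trace
      = ((Uᴴ * A * U) * S * (Uᴴ * A * U) * S).trace := by
  have h : A * (U * S * Uᴴ) * A * (U * S * Uᴴ) = (A * U * S * Uᴴ * A * U * S) * Uᴴ := by
    simp only [Matrix.mul_assoc]
  rw [h, Matrix.trace_mul_comm]
  simp only [Matrix.mul_assoc]

theorem norm_smul_gram_sq (hNm : 0 < Nm) (hNe : 0 < Ne)
    (i j : Fin (multiplicity Hm He Nm Ne)) :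
    ‖(u.matᴴ * ((√(Nm / Ne) • He)ᴴ * (√(Nm / Ne) • He)) * u.mat) j i‖ ^ 2
      = Nm ^ 2 / Ne ^ 2 * ‖star (u.vec j) ⬝ᵥ (Heᴴ * He) *ᵥ u.vec i‖ ^ 2 := by
  rw [conjTranspose_sqrt_smul_mul (by positivity), u.conjTranspose_mul_mul_mat_apply,
    Matrix.smul_mulVec, dotProduct_smul, norm_smul, mul_pow, Real.norm_of_nonneg (by positivity),
    div_pow]

theorem quadForm_eq_curv (hNm : 0 < Nm) (hNe : 0 < Ne)
    (α : Fin (multiplicity Hm He Nm Ne) → ℝ) :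
    quadForm u α = curv Hm (√(Nm / Ne) • He) (eigenCov u α) (eigenCov u α) := by
  rw [curv, u.eigenCov_eq, trace_compression, trace_compression,
    trace_mul_diagonal_mul_diagonal (Matrix.isHermitian_conjTranspose_mul_mul _
      (Matrix.isHermitian_conjTranspose_mul_self _)),
    trace_mul_diagonal_mul_diagonal (Matrix.isHermitian_conjTranspose_mul_mul _
      (Matrix.isHermitian_conjTranspose_mul_self _)), quadForm, ← Finset.sum_sub_distrib]
  refine Finset.sum_congr rfl fun i _ => ?_
  rw [← Finset.sum_sub_distrib]
  refine Finset.sum_congr rfl fun j _ => ?_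
  rw [← mul_sub, norm_smul_gram_sq u hNm hNe, u.conjTranspose_mul_mul_mat_apply]

/-- In a basis of the eigenspace that diagonalizes `H_m† H_m`, forgetting the off-diagonal
entries of a covariance matrix decreases `curv`. -/
theorem IsTraceMax.quadForm_weight_le (hT : 0 < nT) (hNm : 0 < Nm) (hNe : 0 < Ne)
    (hr : 0 < lambdaMax Hm He Nm Ne) {Q : Matrix (Fin nT) (Fin nT) ℂ}
    (hQ : IsTraceMax (Phi Hm He Nm Ne) Q)
    (hu : ∀ i j, i ≠ j → star (u.vec j) ⬝ᵥ (Hmᴴ * Hm) *ᵥ u.vec i = 0) :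
    quadForm u (u.weight Q) ≤ curv Hm (√(Nm / Ne) • He) Q Q := by
  obtain ⟨lam, hlam⟩ : ∃ lam, lam = lambdaMax Hm He Nm Ne := ⟨_, rfl⟩
  obtain ⟨A, hA⟩ : ∃ A, A = u.matᴴ * (Hmᴴ * Hm) * u.mat := ⟨_, rfl⟩
  obtain ⟨B, hB⟩ : ∃ B, B = u.matᴴ * ((√(Nm / Ne) • He)ᴴ * (√(Nm / Ne) • He)) * u.mat := ⟨_, rfl⟩
  obtain ⟨S, hS⟩ : ∃ S, S = u.matᴴ * Q * u.mat := ⟨_, rfl⟩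
  have hSh : S.IsHermitian := by
    rw [hS]; exact Matrix.isHermitian_conjTranspose_mul_mul _ hQ.1.1.isHermitian
  have hBpsd : B.PosSemidef := by
    rw [hB]
    exact (Matrix.posSemidef_conjTranspose_mul_self _).conjTranspose_mul_mul_same _
  -- Φ compresses to a scalar on E, so a basis that diagonalizes one Gram matrix there diagonalizes
  -- the other.
  have hAB : A = B + lam • (1 : Matrix _ _ ℂ) := by
    have h1 : u.matᴴ * (Phi Hm He Nm Ne * u.mat) = lam • (1 : Matrix _ _ ℂ) := by
      rw [u.Phi_mul_mat, Matrix.mul_smul, u.conjTranspose_mat_mul_mat, hlam]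
    rw [Phi_eq (by positivity), Matrix.sub_mul, Matrix.mul_sub,
      ← Matrix.mul_assoc u.matᴴ (Hmᴴ * Hm),
      ← Matrix.mul_assoc u.matᴴ ((√(Nm / Ne) • He)ᴴ * (√(Nm / Ne) • He)), ← hA, ← hB, sub_eq_iff_eq_add'] at h1
    exact h1
  obtain ⟨b, hb0, hb⟩ : ∃ b : Fin (multiplicity Hm He Nm Ne) → ℝ,
      (∀ i, 0 ≤ b i) ∧ B = Matrix.diagonal fun i => (b i : ℂ) := by
    refine ⟨fun i => (B i i).re, fun i => (Complex.nonneg_iff.1 hBpsd.diag_nonneg).1, ?_⟩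
    ext j i
    rw [Matrix.diagonal_apply]
    split_ifs with h
    · subst h
      exact Complex.ext rfl (by simp [← (Complex.nonneg_iff.1 (hBpsd.diag_nonneg (i := j))).2])
    · have h1 := congrFun (congrFun hAB j) i
      rw [hA, u.conjTranspose_mul_mul_mat_apply, hu i j (_root_.Ne.symm h)] at h1
      simpa [Matrix.one_apply_ne h] using h1.symm
  have ha : A = Matrix.diagonal fun i => ((b i + lam : ℝ) : ℂ) := by
    rw [hAB, hb, ← Matrix.diagonal_one, ← Matrix.diagonal_smul, Matrix.diagonal_add]
    congr 1
    ext i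
    simp
  have hcurv : curv Hm (√(Nm / Ne) • He) Q Q
      = ∑ i, ∑ j, ((b i + lam) * (b j + lam) - b i * b j) * ‖S j i‖ ^ 2 := by
    have h1 := hQ.mat_mul_mul_mat u hT hr.le
    rw [← hS] at h1
    rw [curv, ← h1, trace_compression, trace_compression, ← hA, ← hB, Matrix.trace_mul_comm,
      ← Matrix.mul_assoc, ← Matrix.mul_assoc, Matrix.trace_mul_comm (B * S * B),
      ← Matrix.mul_assoc, ← Matrix.mul_assoc, ha, hb, trace_mul_diagonal_mul_diagonal hSh,
      trace_mul_diagonal_mul_diagonal hSh, ← Finset.sum_sub_distrib]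
    refine Finset.sum_congr rfl fun i _ => ?_
    rw [← Finset.sum_sub_distrib]
    exact Finset.sum_congr rfl fun j _ => (sub_mul _ _ _).symm
  have hquad : quadForm u (u.weight Q)
      = ∑ i, ((b i + lam) * (b i + lam) - b i * b i) * ‖S i i‖ ^ 2 := by
    refine Finset.sum_congr rfl fun i _ => ?_
    have hoff : ∀ j, j ≠ i → (u.matᴴ * (Hmᴴ * Hm) * u.mat) j i = 0 ∧
        (u.matᴴ * ((√(Nm / Ne) • He)ᴴ * (√(Nm / Ne) • He)) * u.mat) j i = 0 := fun j hj => by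
      rw [← hA, ← hB, ha, hb, Matrix.diagonal_apply_ne _ hj, Matrix.diagonal_apply_ne _ hj]
      exact ⟨rfl, rfl⟩
    have hw : ‖S i i‖ = |u.weight Q i| := by
      have h1 : S i i = (u.weight Q i : ℂ) := by
        rw [hS, u.conjTranspose_mul_mul_mat_apply]
        exact Complex.ext rfl (hQ.1.1.isHermitian.im_star_dotProduct_mulVec_self _)
      rw [h1, Complex.norm_real, Real.norm_eq_abs]
    rw [Finset.sum_eq_single i]
    · rw [← norm_smul_gram_sq u hNm hNe, ← u.conjTranspose_mul_mul_mat_apply, ← hA, ← hB, ha, hb,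
        Matrix.diagonal_apply_eq, Matrix.diagonal_apply_eq, Complex.norm_real, Complex.norm_real,
        Real.norm_eq_abs, Real.norm_eq_abs, sq_abs, sq_abs, hw, sq_abs]
      ring
    · intro j _ hj
      rw [← norm_smul_gram_sq u hNm hNe, ← u.conjTranspose_mul_mul_mat_apply, (hoff j hj).1,
        (hoff j hj).2]
      simp
    · simp
  rw [hcurv, hquad]
  refine Finset.sum_le_sum fun i _ => ?_
  -- The coefficients are λ(b_i + b_j) + λ² ≥ 0, so keeping only j = i decreases the sum.
  refine Finset.single_le_sum (f := fun j => ((b i + lam) * (b j + lam) - b i * b j) * ‖S j i‖ ^ 2)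
    (fun j _ => mul_nonneg ?_ (sq_nonneg _)) (Finset.mem_univ i)
  have h1 : 0 ≤ lam := hlam ▸ hr.le
  have h2 := mul_nonneg (hb0 i) h1
  have h3 := mul_nonneg (hb0 j) h1
  nlinarith [mul_nonneg h1 h1]

theorem exists_isLeast_curv (hT : 0 < nT) (hr : 0 ≤ lambdaMax Hm He Nm Ne) :
    ∃ m, IsLeast ((fun Q => curv Hm (√(Nm / Ne) • He) Q Q) '' {Q | IsTraceMax (Phi Hm He Nm Ne) Q})
      m := by
  obtain ⟨α, hα⟩ := exists_mem_stdSimplex (Hm := Hm) (He := He) (Nm := Nm) (Ne := Ne) hT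
  obtain ⟨u, -⟩ := exists_topBasis_diagonalizing (Hm := Hm) (He := He) (Nm := Nm) (Ne := Ne)
    (isHermitian_Phi Hm He Nm Ne)
  have hclosed : IsClosed {Q | ∀ Q' ∈ admissible nT 1,
      (Phi Hm He Nm Ne * Q').trace.re ≤ (Phi Hm He Nm Ne * Q).trace.re} := by
    simp only [Set.ofPred_forall]
    exact isClosed_iInter fun Q' => isClosed_iInter fun _ =>
      isClosed_le continuous_const (by fun_prop)
  have hcompact : IsCompact {Q | IsTraceMax (Phi Hm He Nm Ne) Q} :=
    (isCompact_admissible 1).inter_right hclosed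
  obtain ⟨Q, hQ, hmin⟩ := hcompact.exists_isMinOn ⟨_, isTraceMax_eigenCov u hr hα⟩
    (f := fun Q => curv Hm (√(Nm / Ne) • He) Q Q)
    ((continuous_curv _ _).comp (continuous_id.prodMk continuous_id)).continuousOn
  exact ⟨_, ⟨Q, hQ, rfl⟩, by rintro _ ⟨P, hP, rfl⟩; exact hmin hP⟩

end Reduction

/-! ### Derivatives of the capacity -/

section Capacity

open Filter Topology

variable {nT nR nE : ℕ} {Hm : Matrix (Fin nR) (Fin nT) ℂ} {He : Matrix (Fin nE) (Fin nT) ℂ}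
  {Nm Ne : ℝ}

theorem hasDerivWithinAt_secrecyCapacity (hR : 0 < nR) (hNm : 0 < Nm) (hNe : 0 < Ne) {s d : ℝ}
    (hs : 0 ≤ s)
    (h : HasDerivWithinAt (gapSup Hm (√(Nm / Ne) • He)) d (Set.Ici 0) (nR * s)) :
    HasDerivWithinAt (secrecyCapacity Hm He Nm Ne) d (Set.Ici 0) s := by
  have hR0 : (nR : ℝ) ≠ 0 := by exact_mod_cast hR.ne'
  have h1 : HasDerivWithinAt (fun x : ℝ => (nR : ℝ) * x) nR (Set.Ici 0) s := by
    simpa using ((hasDerivAt_id s).const_mul (nR : ℝ)).hasDerivWithinAt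
  have h2 := (h.comp s h1 fun x hx =>
    Set.mem_Ici.2 (mul_nonneg (Nat.cast_nonneg nR) (Set.mem_Ici.1 hx))).const_mul (1 / (nR : ℝ))
  rw [show 1 / (nR : ℝ) * (d * nR) = d by field_simp] at h2
  exact h2.congr (fun x hx => secrecyCapacity_eq hNm hNe hx) (secrecyCapacity_eq hNm hNe hs)

theorem hasDerivWithinAt_secrecyRate_power (hR : 0 < nR) (hNm : 0 < Nm) (hNe : 0 < Ne)
    {Q : Matrix (Fin nT) (Fin nT) ℂ} (hQ : Q.PosSemidef) :
    HasDerivWithinAt (fun s : ℝ => secrecyRate Hm He Nm Ne (power nR Nm s • Q))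
      (Phi Hm He Nm Ne * Q).trace.re (Set.Ici 0) 0 := by
  have hR0 : (nR : ℝ) ≠ 0 := by exact_mod_cast hR.ne'
  simp only [secrecyRate_power_smul hNm hNe]
  have h := hasDerivAt_gap_smul Hm (√(Nm / Ne) • He) hQ le_rfl
  rw [zero_smul, gapGrad_zero, ← Phi_eq (by positivity), ← mul_zero (nR : ℝ)] at h
  have h1 : HasDerivAt (fun x : ℝ => (nR : ℝ) * x) nR 0 := by
    simpa using (hasDerivAt_id (0 : ℝ)).const_mul (nR : ℝ)
  have h2 := (h.comp (0 : ℝ) h1).const_mul (1 / (nR : ℝ))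
  rw [show ∀ d : ℝ, 1 / (nR : ℝ) * (d * nR) = d from fun d => by field_simp] at h2
  exact h2.hasDerivWithinAt

theorem isLeast_quadForm (hT : 0 < nT) (hNm : 0 < Nm) (hNe : 0 < Ne)
    (hr : 0 < lambdaMax Hm He Nm Ne) {m : ℝ}
    (hm : IsLeast ((fun Q => curv Hm (√(Nm / Ne) • He) Q Q) ''
      {Q | IsTraceMax (Phi Hm He Nm Ne) Q}) m) :
    IsLeast {q : ℝ | ∃ u : TopBasis Hm He Nm Ne,
      ∃ α ∈ stdSimplex ℝ (Fin (multiplicity Hm He Nm Ne)), q = quadForm u α} m := by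
  refine ⟨?_, ?_⟩
  · obtain ⟨Q, hQ, hQm⟩ := hm.1
    obtain ⟨u, α, hα, rfl⟩ := IsTraceMax.exists_eq_eigenCov hT hr hQ
    exact ⟨u, α, hα, by rw [quadForm_eq_curv u hNm hNe]; exact hQm.symm⟩
  · rintro _ ⟨u, α, hα, rfl⟩
    rw [quadForm_eq_curv u hNm hNe]
    exact hm.2 ⟨_, isTraceMax_eigenCov u hr.le hα, rfl⟩

/-- Let Q be a minimizer over the whole maximizing face. Its diagonal weights in the given basis do
at least as well as Q, so they attain the global minimum. -/
theorem isLeast_quadForm_of_diagonalizing (hT : 0 < nT) (hNm : 0 < Nm) (hNe : 0 < Ne)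
    (hr : 0 < lambdaMax Hm He Nm Ne) {m : ℝ}
    (hm : IsLeast ((fun Q => curv Hm (√(Nm / Ne) • He) Q Q) ''
      {Q | IsTraceMax (Phi Hm He Nm Ne) Q}) m) (u : TopBasis Hm He Nm Ne)
    (hu : ∀ i j, i ≠ j → star (u.vec j) ⬝ᵥ (Hmᴴ * Hm) *ᵥ u.vec i = 0) :
    IsLeast (quadForm u '' stdSimplex ℝ (Fin (multiplicity Hm He Nm Ne))) m := by
  have hlower : ∀ α ∈ stdSimplex ℝ (Fin (multiplicity Hm He Nm Ne)), m ≤ quadForm u α :=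
    fun α hα => (isLeast_quadForm hT hNm hNe hr hm).2 ⟨u, α, hα, rfl⟩
  refine ⟨?_, by rintro _ ⟨α, hα, rfl⟩; exact hlower α hα⟩
  obtain ⟨Q, hQ, hQm⟩ := hm.1
  have hw := IsTraceMax.weight_mem u hT hr hQ
  exact ⟨_, hw, le_antisymm ((IsTraceMax.quadForm_weight_le u hT hNm hNe hr hQ hu).trans_eq hQm)
    (hlower _ hw)⟩

/-- For a positive largest eigenvalue the capacity is differentiable near zero, and the second
derivative at zero is minus `nR` times the least curvature over the covariances in the top
eigenspace. -/
theorem exists_deriv_secrecyCapacity (hT : 0 < nT) (hR : 0 < nR) (hNm : 0 < Nm) (hNe : 0 < Ne)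
    (hr : 0 < lambdaMax Hm He Nm Ne) {m : ℝ}
    (hm : IsLeast ((fun Q => curv Hm (√(Nm / Ne) • He) Q Q) ''
      {Q | IsTraceMax (Phi Hm He Nm Ne) Q}) m) :
    ∃ C' : ℝ → ℝ,
      (∃ ε : ℝ, 0 < ε ∧ ∀ s ∈ Set.Ico 0 ε,
        HasDerivWithinAt (secrecyCapacity Hm He Nm Ne) (C' s) (Set.Ici 0) s) ∧
      C' 0 = lambdaMax Hm He Nm Ne ∧ HasDerivWithinAt C' (-(nR * m)) (Set.Ici 0) 0 := by
  have hR0 : (0 : ℝ) < nR := by exact_mod_cast hR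
  have hsel : ∀ t : ℝ, ∃ Q ∈ admissible nT 1, 0 ≤ t → ∀ Q' ∈ admissible nT 1,
      gap Hm (√(Nm / Ne) • He) (t • Q') ≤ gap Hm (√(Nm / Ne) • He) (t • Q) := fun t => by
    rcases le_or_gt 0 t with ht | ht
    · obtain ⟨Q, hQ, h⟩ := exists_forall_gap_le Hm (√(Nm / Ne) • He) ht
      exact ⟨Q, hQ, fun _ => h⟩
    · exact ⟨0, zero_mem_admissible zero_le_one, fun h => absurd h ht.not_ge⟩
  choose opt hopt hmax using hsel
  have htr := fun Q (hQ : IsTraceMax (Phi Hm He Nm Ne) Q) => hQ.trace_Phi_eq hT hr.le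
  obtain ⟨Q₀, h₀, -⟩ := hm.1
  have hr₀ := htr Q₀ h₀
  rw [Phi_eq (by positivity)] at hm htr h₀ hr₀
  obtain ⟨hzero, ε, hε, hder⟩ := exists_hasDerivWithinAt_gapSup hr h₀ hr₀ hopt hmax
  have hslope := tendsto_slope_trace_gapGrad hr hm htr hopt hmax
  obtain ⟨ψ, hψ⟩ : ∃ ψ : ℝ → ℝ, ψ = fun t =>
    (gapGrad Hm (√(Nm / Ne) • He) (t • opt t) * opt t).trace.re := ⟨_, rfl⟩
  -- The value at 0 is prescribed: at t = 0 every admissible Q is a maximizer, so ψ 0 = tr(Φ · `opt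
  -- 0`) depends on an arbitrary choice.
  refine ⟨fun s => if s = 0 then lambdaMax Hm He Nm Ne else ψ (nR * s), ⟨ε / nR, by positivity,
    fun s hs => ?_⟩, if_pos rfl, ?_⟩
  · refine hasDerivWithinAt_secrecyCapacity hR hNm hNe hs.1 ?_
    beta_reduce
    rcases hs.1.eq_or_lt with h | h
    · rw [← h, if_pos rfl, mul_zero]
      exact hzero
    · rw [if_neg h.ne', hψ]
      have hs2 := hs.2
      rw [lt_div_iff₀ hR0] at hs2
      exact hder _ ⟨by positivity, by linarith⟩
  · rw [← hasDerivWithinAt_Ioi_iff_Ici,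
      hasDerivWithinAt_iff_tendsto_slope' (Set.self_notMem_Ioi)]
    have hscale : Tendsto (fun s : ℝ => (nR : ℝ) * s) (𝓝[>] 0) (𝓝[>] 0) := by
      refine tendsto_nhdsWithin_iff.2 ⟨?_, ?_⟩
      · have : Tendsto (fun s : ℝ => (nR : ℝ) * s) (𝓝 0) (𝓝 (nR * 0)) :=
          tendsto_id.const_mul _
        rw [mul_zero] at this
        exact this.mono_left nhdsWithin_le_nhds
      · filter_upwards [self_mem_nhdsWithin] with s hs
        exact mul_pos hR0 hs
    have h1 := (hslope.comp hscale).const_mul (nR : ℝ)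
    rw [mul_neg] at h1
    refine h1.congr' ?_
    filter_upwards [self_mem_nhdsWithin] with s hs
    have hs0 : s ≠ 0 := (Set.mem_Ioi.1 hs).ne'
    rw [slope_def_field, if_neg hs0, if_pos rfl, hψ, sub_zero]
    simp only [Function.comp_apply]
    field_simp

end Capacity

end Wiretap

end

/-! ### Assembly of the theorem -/

theorem theorem1 {nT nR nE : ℕ} (hT : 0 < nT) (hR : 0 < nR)
    (Hm : Matrix (Fin nR) (Fin nT) ℂ) (He : Matrix (Fin nE) (Fin nT) ℂ)
    (Nm Ne : ℝ) (hNm : 0 < Nm) (hNe : 0 < Ne) :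
    -- the supremum that defines the capacity is a maximum
    (∀ snr : ℝ, 0 ≤ snr →
      IsGreatest (Wiretap.secrecyRate Hm He Nm Ne '' Wiretap.admissible nT (Wiretap.power nR Nm snr))
        (Wiretap.secrecyCapacity Hm He Nm Ne snr)) ∧
    -- the capacity is differentiable near zero, and its first two derivatives at zero are as claimed
    (∃ C' : ℝ → ℝ,
      (∃ ε : ℝ, 0 < ε ∧ ∀ snr ∈ Set.Ico 0 ε,
        HasDerivWithinAt (Wiretap.secrecyCapacity Hm He Nm Ne) (C' snr) (Set.Ici 0) snr) ∧
      C' 0 = max (Wiretap.lambdaMax Hm He Nm Ne) 0 ∧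
      (0 < Wiretap.lambdaMax Hm He Nm Ne →
        ∃ m : ℝ,
          -- the minimum over all weights and all orthonormal bases of the eigenspace
          IsLeast {q : ℝ | ∃ u : Wiretap.TopBasis Hm He Nm Ne,
            ∃ α ∈ stdSimplex ℝ (Fin (Wiretap.multiplicity Hm He Nm Ne)),
              q = Wiretap.quadForm u α} m ∧
          -- which is the minimum over the weights alone for a basis that diagonalizes `H_m† H_m`
          (∃ u : Wiretap.TopBasis Hm He Nm Ne, ∀ i j, i ≠ j →
            star (u.vec j) ⬝ᵥ (Hmᴴ * Hm) *ᵥ u.vec i = 0) ∧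
          (∀ u : Wiretap.TopBasis Hm He Nm Ne,
            (∀ i j, i ≠ j → star (u.vec j) ⬝ᵥ (Hmᴴ * Hm) *ᵥ u.vec i = 0) →
            IsLeast (Wiretap.quadForm u ''
              stdSimplex ℝ (Fin (Wiretap.multiplicity Hm He Nm Ne))) m) ∧
          HasDerivWithinAt C' (-(nR * m)) (Set.Ici 0) 0) ∧
      (Wiretap.lambdaMax Hm He Nm Ne ≤ 0 → HasDerivWithinAt C' 0 (Set.Ici 0) 0)) ∧
    -- transmission in the eigenspace is admissible and attains the first derivative
    (∀ (u : Wiretap.TopBasis Hm He Nm Ne),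
      ∀ α ∈ stdSimplex ℝ (Fin (Wiretap.multiplicity Hm He Nm Ne)),
        (∀ snr : ℝ, 0 ≤ snr →
          Wiretap.power nR Nm snr • Wiretap.eigenCov u α ∈
            Wiretap.admissible nT (Wiretap.power nR Nm snr)) ∧
        (0 ≤ Wiretap.lambdaMax Hm He Nm Ne →
          HasDerivWithinAt
            (fun snr : ℝ => Wiretap.secrecyRate Hm He Nm Ne
              (Wiretap.power nR Nm snr • Wiretap.eigenCov u α))
            (max (Wiretap.lambdaMax Hm He Nm Ne) 0) (Set.Ici 0) 0)) := by
  refine ⟨fun snr hsnr => ?_, ?_, fun u α hα => ⟨fun snr hsnr => ?_, fun hr => ?_⟩⟩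
  · rw [Wiretap.secrecyCapacity_eq hNm hNe hsnr]
    exact Wiretap.isGreatest_secrecyRate hNm hNe hsnr
  · rcases le_or_gt (Wiretap.lambdaMax Hm He Nm Ne) 0 with hr | hr
    · have hpsd : ((√(Nm / Ne) • He)ᴴ * (√(Nm / Ne) • He) - Hmᴴ * Hm).PosSemidef := by
        have h1 := (Wiretap.posSemidef_lambdaMax_sub_Phi (Hm := Hm) (He := He) (Nm := Nm)
          (Ne := Ne)).add
          ((Matrix.PosSemidef.one (n := Fin nT) (R := ℂ)).smul (neg_nonneg.2 hr))
        rw [Wiretap.Phi_eq (by positivity)] at h1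
        convert h1 using 1
        rw [neg_smul]
        abel
      refine ⟨fun _ => 0, ⟨1, one_pos, fun s hs => ?_⟩, (max_eq_right hr).symm,
        fun h => absurd hr h.not_ge, fun _ => hasDerivWithinAt_const _ _ _⟩
      have hzero : ∀ x ∈ Set.Ici (0 : ℝ), Wiretap.secrecyCapacity Hm He Nm Ne x = 0 :=
        fun x hx => by
          rw [Wiretap.secrecyCapacity_eq hNm hNe hx,
            Wiretap.gapSup_eq_zero hpsd (mul_nonneg (Nat.cast_nonneg nR) hx), mul_zero]
      exact (hasDerivWithinAt_const s _ (0 : ℝ)).congr hzero (hzero s hs.1)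
    · obtain ⟨m, hm⟩ := Wiretap.exists_isLeast_curv (Hm := Hm) (He := He) (Nm := Nm) (Ne := Ne)
        hT hr.le
      obtain ⟨C', hder, h0, hder2⟩ :=
        Wiretap.exists_deriv_secrecyCapacity hT hR hNm hNe hr hm
      exact ⟨C', hder, h0.trans (max_eq_left hr.le).symm, fun _ =>
        ⟨m, Wiretap.isLeast_quadForm hT hNm hNe hr hm,
          Wiretap.exists_topBasis_diagonalizing (Matrix.isHermitian_conjTranspose_mul_self Hm),
          Wiretap.isLeast_quadForm_of_diagonalizing hT hNm hNe hr hm, hder2⟩,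
        fun h => absurd hr h.not_gt⟩
  · exact Wiretap.smul_mem_admissible
      (mul_nonneg (mul_nonneg (Nat.cast_nonneg nR) hNm.le) hsnr)
      (Wiretap.eigenCov_mem_admissible u hα)
  · rw [max_eq_left hr, ← Wiretap.trace_Phi_mul_eigenCov u hα]
    exact Wiretap.hasDerivWithinAt_secrecyRate_power hR hNm hNe
      (Wiretap.eigenCov_mem_admissible u hα).1
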